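/- **Setting.** Let $Y_1,\dots,Y_n$ be independent real random variables and let $\Psi_1,\dots,\Psi_n\in\mathbb R^p$ ($p\ge1$) be deterministic vectors such that $V_0^2:=\frac14\sum_i\Psi_i\Psi_i^{\top}$ is positive definite. Put $$L(\theta)=-\tfrac12\sum_{i=1}^n|Y_i-\Psi_i^{\top}\theta|,\qquad L(\theta,\theta')=L(\theta)-L(\theta'),$$ let $\tilde\theta$ be any maximizer of $L$ over $\mathbb R^p$ (the LAD estimator), and let $\theta^*$ be a maximizer of $\mathbb E L(\theta)$, that is, $\mathbb E L(\theta,\theta^*)\le 0$ for all $\theta$. Suppose that each residual $Y_i-\Psi_i^{\top}\theta^*$ has a density $p_i$, and put $$D_0^2=\sum_i p_i(0)\,\Psi_i\Psi_i^{\top},\qquad \xi=D_0^{-1}\nabla L(\theta^*),\qquad N^{-1/2}=\max_i\sup_{\gamma\in\mathbb R^p,\ \gamma\ne0}\frac{\Psi_i^{\top}\gamma}{2\|V_0\gamma\|},$$ where $V_0$ and $D_0$ are the positive definite square roots of $V_0^2$ and $D_0^2$. **Theorem.** For all constants $C>0$ and $\mathfrak a>0$ there are constants $C_2>0$, $K>0$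 and a function $\kappa:\mathbb R\to\mathbb R$ with $\kappa(t)\to0$ as $t\to\infty$, all depending only on $C$ and $\mathfrak a$, such that the following holds for all $n$, $p$, all $\Psi_i$, $Y_i$, $\theta^*$ and $p_i$ as above, and all $\rho>0$, $0<\delta<1/2$, $x>0$. Suppose that for all $i$ $$\sup_u p_i(u)\le C,\qquad p_i(0)\ge\mathfrak a^2/4,\qquad \Bigl|\frac{p_i(u)}{p_i(0)}-1\Bigr|\le\delta\quad\text{for } |u|\le\rho,$$ and that $N\ge C_2\,\rho^{-2}\mathfrak a^2(x+p)$. Then there is an event of probability at least $1-e^{-x}$ on which every LAD estimator $\tilde\theta$ satisfies $$\bigl\|D_0(\tilde\theta-\theta^*)-\xi\bigr\|^2\le\Bigl(K\delta+\kappa\bigl(\tfrac{N}{x+p}\bigr)\Bigr)(x+p),\qquad \bigl|2L(\tilde\theta,\theta^*)-\|\xi\|^2\bigr|\le\Bigl(K\delta+\kappa\bigl(\tfrac{N}{x+p}\bigr)\Bigr)(x+p).$$ In particular, for fixed $x$, $C$, $\mathfrak a$ both errors are $o(p)$ as $N/p\to\infty$ and $\delta\to0$. -/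

import Mathlib

open MeasureTheory ProbabilityTheory Filter Topology

namespace LAD

noncomputable section

/-- The Laplace quasi log-likelihood `L(θ) = -(1/2) ∑ |yᵢ - Ψᵢᵀ θ|` of the linear model with
features `Ψᵢ` at the data `y`. Its maximizers are the least absolute deviation estimates. -/
def logLik {n p : ℕ} (Ψ : Fin n → EuclideanSpace ℝ (Fin p)) (y : Fin n → ℝ)
    (θ : EuclideanSpace ℝ (Fin p)) : ℝ :=
  -(1 / 2) * ∑ i, |y i - inner ℝ (Ψ i) θ|

/-- `V₀² = (1/4) ∑ Ψᵢ Ψᵢᵀ`. -/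
def V0sq {n p : ℕ} (Ψ : Fin n → EuclideanSpace ℝ (Fin p)) : Matrix (Fin p) (Fin p) ℝ :=
  (1 / 4 : ℝ) • ∑ i, Matrix.vecMulVec (Ψ i).ofLp (Ψ i).ofLp

/-- `D₀² = ∑ dᵢ(0) Ψᵢ Ψᵢᵀ`, where `dᵢ` is the density of the `i`-th residual. -/
def D0sq {n p : ℕ} (Ψ : Fin n → EuclideanSpace ℝ (Fin p)) (dens : Fin n → ℝ → ℝ) :
    Matrix (Fin p) (Fin p) ℝ :=
  ∑ i, dens i 0 • Matrix.vecMulVec (Ψ i).ofLp (Ψ i).ofLp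

open scoped MatrixOrder in
/-- The positive semidefinite square root of a positive semidefinite real matrix. -/
def posSqrt {p : ℕ} (M : Matrix (Fin p) (Fin p) ℝ) : Matrix (Fin p) (Fin p) ℝ :=
  CFC.sqrt M

open scoped MatrixOrder in
theorem posSqrt_posSemidef {p : ℕ} (M : Matrix (Fin p) (Fin p) ℝ) :
    (posSqrt M).PosSemidef :=
  Matrix.nonneg_iff_posSemidef.mp (CFC.sqrt_nonneg M)

open scoped MatrixOrder in
theorem posSqrt_mul_self {p : ℕ} {M : Matrix (Fin p) (Fin p) ℝ} (hM : M.PosSemidef) :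
    posSqrt M * posSqrt M = M :=
  CFC.sqrt_mul_sqrt_self M (Matrix.nonneg_iff_posSemidef.mpr hM)

/-- `V₀`, the square root of `V₀²`. -/
def V0 {n p : ℕ} (Ψ : Fin n → EuclideanSpace ℝ (Fin p)) : Matrix (Fin p) (Fin p) ℝ :=
  posSqrt (V0sq Ψ)

/-- `D₀`, the square root of `D₀²`. -/
def D0 {n p : ℕ} (Ψ : Fin n → EuclideanSpace ℝ (Fin p)) (dens : Fin n → ℝ → ℝ) :
    Matrix (Fin p) (Fin p) ℝ :=
  posSqrt (D0sq Ψ dens)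

/-- A matrix acting on Euclidean space. -/
def act {p : ℕ} (M : Matrix (Fin p) (Fin p) ℝ) (v : EuclideanSpace ℝ (Fin p)) :
    EuclideanSpace ℝ (Fin p) :=
  WithLp.toLp 2 (M.mulVec v.ofLp)

/-- The effective sample size `N`, defined by
`N^{-1/2} = max_i sup_γ Ψᵢᵀ γ / (2 ‖V₀ γ‖)`.  For `V₀² > 0` the suprema are finite, and the
convention `0 / 0 = 0` at `γ = 0` does not change them. -/
def effN {n p : ℕ} (Ψ : Fin n → EuclideanSpace ℝ (Fin p)) : ℝ :=
  ((⨆ i, ⨆ γ : EuclideanSpace ℝ (Fin p), inner ℝ (Ψ i) γ / (2 * ‖act (V0 Ψ) γ‖)) ^ 2)⁻¹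

/-- The normalized score `ξ = D₀⁻¹ ∇L(θ*)` at the data `y`. -/
def score {n p : ℕ} (Ψ : Fin n → EuclideanSpace ℝ (Fin p)) (dens : Fin n → ℝ → ℝ)
    (θs : EuclideanSpace ℝ (Fin p)) (y : Fin n → ℝ) : EuclideanSpace ℝ (Fin p) :=
  act (D0 Ψ dens)⁻¹ (gradient (logLik Ψ y) θs)

end

end LAD

namespace LAD

noncomputable section

/-! In the coordinates u = D₀(θ - θ*), with αᵢ = D₀⁻¹Ψᵢ, the difference L(θ, θ*) equals ⟨ξ, u⟩ -
f(u) exactly. Here ξ is half the sum of the αᵢ signed by the residuals (almost surely the normalized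
gradient), and f = `remSum` is nonnegative, convex and zero at 0. If f(u) were ‖u‖²/2, the maximizer
would be ξ and twice the maximum ‖ξ‖². With q = x + p, it therefore suffices that f is close to
‖u‖²/2 on a ball whose radius is a large multiple of √q, and that ‖ξ‖ is a smaller multiple of √q.
Concavity of the objective traps every maximizer in that ball (`maximizer_of_quadratic_approx`).

Mean of f: each summand is, as a function of the residual, a triangle of area t²/2 next to the kink,
with t = ⟨αᵢ, u⟩. Its expectation is pᵢ(0)t²/2 up to a relative error δ, and the normalization by D₀
sums these to ‖u‖²/2.

Fluctuation of f: a summand is nonzero only with probability O(|t|), so its second moment is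
O(|t|³), and large N forces |t| ≤ ε⁴ with ε of order (q/N)^(1/8). The Bernstein bound then beats the
e^(2p/ε) points of an ε-net (`remSum_tail`). Convexity turns bounds on the net into a Lipschitz
bound, which carries the approximation to the ball (`quadratic_approx_of_net`).

The score has mean zero by optimality of θ*, and a net of mesh 1/2 controls its norm (`score_tail`).
-/

/-! ### Bernstein tail bounds. -/

theorem exp_le_one_add_add_sq {y : ℝ} (hy : |y| ≤ 1) : Real.exp y ≤ 1 + y + y ^ 2 := by
  have := (abs_le.1 (Real.abs_exp_sub_one_sub_id_le hy)).2
  linarith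

theorem integrable_of_abs_le {Ω : Type*} [MeasurableSpace Ω] {P : Measure Ω}
    [IsProbabilityMeasure P] {X : Ω → ℝ} (hX : Measurable X) {c : ℝ} (hb : ∀ ω, |X ω| ≤ c) :
    Integrable X P :=
  Integrable.of_bound hX.aestronglyMeasurable c (Eventually.of_forall hb)

theorem mgf_le_of_abs_le {Ω : Type*} [MeasurableSpace Ω] {P : Measure Ω}
    [IsProbabilityMeasure P] {X : Ω → ℝ} (hX : Measurable X) {c l : ℝ} (hb : ∀ ω, |X ω| ≤ c)
    (hl : 0 ≤ l) (hlc : l * c ≤ 1) :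
    mgf X P l ≤ Real.exp (l * ∫ ω, X ω ∂P + l ^ 2 * ∫ ω, X ω ^ 2 ∂P) := by
  have hi : Integrable X P := integrable_of_abs_le hX hb
  have hi2 : Integrable (fun ω => X ω ^ 2) P :=
    integrable_of_abs_le (hX.pow_const 2) (c := c ^ 2) fun ω => by
      rw [abs_pow]
      exact pow_le_pow_left₀ (abs_nonneg _) (hb ω) 2
  have hlX : ∀ ω, |l * X ω| ≤ 1 := fun ω => by
    rw [abs_mul, abs_of_nonneg hl]
    exact (mul_le_mul_of_nonneg_left (hb ω) hl).trans hlc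
  have h1 : mgf X P l ≤ ∫ ω, (1 + l * X ω + l ^ 2 * X ω ^ 2) ∂P := by
    refine integral_mono_of_nonneg (Eventually.of_forall fun ω => (Real.exp_pos _).le)
      (((integrable_const _).add (hi.const_mul l)).add (hi2.const_mul _))
      (Eventually.of_forall fun ω => ?_)
    have := exp_le_one_add_add_sq (hlX ω)
    simp only
    rw [mul_pow] at this
    exact this
  have h2 : ∫ ω, (1 + l * X ω + l ^ 2 * X ω ^ 2) ∂P
      = 1 + (l * ∫ ω, X ω ∂P + l ^ 2 * ∫ ω, X ω ^ 2 ∂P) := by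
    have hi' : Integrable (fun ω => 1 + l * X ω) P := (integrable_const _).add (hi.const_mul l)
    rw [integral_add hi' (hi2.const_mul _),
      integral_add (integrable_const _) (hi.const_mul l), integral_const_mul, integral_const_mul]
    simp
    ring
  rw [h2] at h1
  refine h1.trans ?_
  have := Real.add_one_le_exp (l * ∫ ω, X ω ∂P + l ^ 2 * ∫ ω, X ω ^ 2 ∂P)
  linarith

/-- A Bernstein type upper tail bound for sums of bounded independent random variables. -/
theorem upper_tail_sum_le {Ω ι : Type*} [Fintype ι] [MeasurableSpace Ω] {P : Measure Ω}
    [IsProbabilityMeasure P] {X : ι → Ω → ℝ} (hX : ∀ i, Measurable (X i)) (hind : iIndepFun X P)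
    {c l v : ℝ} (hb : ∀ i ω, |X i ω| ≤ c) (hl : 0 ≤ l) (hlc : l * c ≤ 1)
    (hv : ∑ i, ∫ ω, X i ω ^ 2 ∂P ≤ v) (τ : ℝ) :
    P.real {ω | τ ≤ ∑ i, X i ω - ∑ i, ∫ ω', X i ω' ∂P} ≤ Real.exp (-l * τ + l ^ 2 * v) := by
  set m := ∑ i, ∫ ω', X i ω' ∂P with hm
  have hset : {ω | τ ≤ ∑ i, X i ω - m} = {ω | τ + m ≤ (∑ i, X i) ω} := by
    ext ω
    simp only [Set.mem_ofPred_eq, Finset.sum_apply]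
    constructor <;> intro h <;> linarith
  have hmeas : Measurable (∑ i, X i) := by
    rw [show ∑ i, X i = fun ω => ∑ i, X i ω by ext; simp]
    exact Finset.measurable_sum _ fun i _ => hX i
  have hint : Integrable (fun ω => Real.exp (l * (∑ i, X i) ω)) P := by
    refine integrable_of_abs_le (hmeas.const_mul l).exp
      (c := Real.exp (l * (Fintype.card ι * c))) fun ω => ?_
    rw [abs_of_pos (Real.exp_pos _)]
    gcongr
    rw [Finset.sum_apply]
    calc ∑ i, X i ω ≤ ∑ _i : ι, c := Finset.sum_le_sum fun i _ => (le_abs_self _).trans (hb i ω)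
      _ = Fintype.card ι * c := by simp
  rw [hset]
  refine (measure_ge_le_exp_mul_mgf (τ + m) hl hint).trans ?_
  rw [hind.mgf_sum hX]
  calc Real.exp (-l * (τ + m)) * ∏ i, mgf (X i) P l
      ≤ Real.exp (-l * (τ + m)) *
        ∏ i, Real.exp (l * ∫ ω, X i ω ∂P + l ^ 2 * ∫ ω, X i ω ^ 2 ∂P) := by
        gcongr with i _
        · exact fun i _ => mgf_nonneg
        · exact mgf_le_of_abs_le (hX i) (hb i) hl hlc
    _ ≤ Real.exp (-l * τ + l ^ 2 * v) := by
        rw [← Real.exp_sum, ← Real.exp_add, Finset.sum_add_distrib, ← Finset.mul_sum,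
          ← Finset.mul_sum, ← hm]
        refine Real.exp_le_exp.2 ?_
        nlinarith [mul_le_mul_of_nonneg_left hv (sq_nonneg l)]

theorem lower_tail_sum_le {Ω ι : Type*} [Fintype ι] [MeasurableSpace Ω] {P : Measure Ω}
    [IsProbabilityMeasure P] {X : ι → Ω → ℝ} (hX : ∀ i, Measurable (X i)) (hind : iIndepFun X P)
    {c l v : ℝ} (hb : ∀ i ω, |X i ω| ≤ c) (hl : 0 ≤ l) (hlc : l * c ≤ 1)
    (hv : ∑ i, ∫ ω, X i ω ^ 2 ∂P ≤ v) (τ : ℝ) :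
    P.real {ω | τ ≤ ∑ i, ∫ ω', X i ω' ∂P - ∑ i, X i ω} ≤ Real.exp (-l * τ + l ^ 2 * v) := by
  have hind' : iIndepFun (fun i ω => -X i ω) P := hind.comp (fun _ y => -y) fun _ => measurable_neg
  have := upper_tail_sum_le (fun i => (hX i).neg) hind' (c := c) (v := v)
    (by simpa using hb) hl hlc (by simpa using hv) τ
  refine le_trans (le_of_eq ?_) this
  congr 1
  ext ω
  simp only [Set.mem_ofPred_eq, Pi.neg_apply, Finset.sum_neg_distrib, integral_neg]
  rw [neg_sub_neg]

/-! ### Nets in finite dimensional balls. -/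

section Net

variable {E : Type*} [NormedAddCommGroup E] [NormedSpace ℝ E] [FiniteDimensional ℝ E]

/-- Volume comparison: the balls of radius εR/2 about the points are disjoint and lie in the ball of
radius R + εR/2. -/
theorem card_le_of_separated_in_closedBall {R ε : ℝ} (hR : 0 < R) (hε : 0 < ε) (s : Finset E)
    (hs : ∀ g ∈ s, ‖g‖ ≤ R) (hsep : ∀ g ∈ s, ∀ h ∈ s, g ≠ h → ε * R ≤ ‖g - h‖) :
    (s.card : ℝ) ≤ (1 + 2 / ε) ^ Module.finrank ℝ E := by
  borelize E
  let μ : Measure E := Measure.addHaar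
  set d := ε * R / 2 with hd
  have hd0 : 0 < d := by positivity
  have hdisj : (s : Set E).PairwiseDisjoint fun c => Metric.ball c d := by
    rintro g hg h hh hgh
    apply Metric.ball_disjoint_ball
    rw [dist_eq_norm]
    have := hsep g hg h hh hgh
    linarith
  have hsub : (⋃ c ∈ s, Metric.ball c d) ⊆ Metric.ball (0 : E) (R + d) := by
    refine Set.iUnion₂_subset fun g hg => Metric.ball_subset_ball' ?_
    rw [dist_zero_right]
    linarith [hs g hg]
  have hI : (s.card : ENNReal) * ENNReal.ofReal (d ^ Module.finrank ℝ E) * μ (Metric.ball 0 1)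
      ≤ ENNReal.ofReal ((R + d) ^ Module.finrank ℝ E) * μ (Metric.ball 0 1) := by
    calc (s.card : ENNReal) * ENNReal.ofReal (d ^ Module.finrank ℝ E) * μ (Metric.ball 0 1)
        = μ (⋃ c ∈ s, Metric.ball c d) := by
          rw [measure_biUnion_finset hdisj fun c _ => measurableSet_ball]
          simp only [μ.addHaar_ball_of_pos _ hd0, Finset.sum_const, nsmul_eq_mul, mul_assoc]
      _ ≤ μ (Metric.ball (0 : E) (R + d)) := measure_mono hsub
      _ = _ := by rw [μ.addHaar_ball_of_pos _ (by positivity)]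
  have hJ := (ENNReal.mul_le_mul_iff_left (Metric.measure_ball_pos _ _ zero_lt_one).ne'
    measure_ball_lt_top.ne).1 hI
  have hK : (s.card : ℝ) * d ^ Module.finrank ℝ E ≤ (R + d) ^ Module.finrank ℝ E := by
    have := ENNReal.toReal_mono ENNReal.ofReal_ne_top hJ
    rwa [ENNReal.toReal_mul, ENNReal.toReal_ofReal (by positivity),
      ENNReal.toReal_ofReal (by positivity), ENNReal.toReal_natCast] at this
  have hq : 1 + 2 / ε = (R + d) / d := by
    rw [hd]
    field_simp
    ring
  rw [hq, div_pow, le_div_iff₀ (by positivity)]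
  exact hK

/-- Balls of a finite dimensional space have nets of exponential size. -/
theorem exists_net_closedBall {R ε : ℝ} (hR : 0 < R) (hε : 0 < ε) :
    ∃ s : Finset E, (∀ g ∈ s, ‖g‖ ≤ R) ∧ (∀ u : E, ‖u‖ ≤ R → ∃ g ∈ s, ‖u - g‖ ≤ ε * R) ∧
      (s.card : ℝ) ≤ Real.exp (2 * Module.finrank ℝ E / ε) := by
  classical
  let Q : Finset E → Prop := fun s =>
    (∀ g ∈ s, ‖g‖ ≤ R) ∧ ∀ g ∈ s, ∀ h ∈ s, g ≠ h → ε * R ≤ ‖g - h‖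
  let S : Set ℕ := {k | ∃ s : Finset E, Q s ∧ s.card = k}
  have hcard : ∀ s, Q s → (s.card : ℝ) ≤ (1 + 2 / ε) ^ Module.finrank ℝ E :=
    fun s hs => card_le_of_separated_in_closedBall hR hε s hs.1 hs.2
  have hbdd : BddAbove S := by
    refine ⟨⌊(1 + 2 / ε) ^ Module.finrank ℝ E⌋₊, ?_⟩
    rintro k ⟨s, hs, rfl⟩
    exact Nat.le_floor (hcard s hs)
  have hne : S.Nonempty := ⟨0, ∅, by simp [Q], rfl⟩
  -- A separated set of maximal cardinality is a net: a point far from all of it could be added.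
  obtain ⟨s, hs, hsc⟩ := Nat.sSup_mem hne hbdd
  refine ⟨s, hs.1, fun u hu => ?_, (hcard s hs).trans ?_⟩
  · by_contra! hcon
    have hus : u ∉ s := fun h => by
      have := hcon u h
      rw [sub_self, norm_zero] at this
      have : 0 < ε * R := by positivity
      linarith
    have hQ : Q (insert u s) := by
      refine ⟨?_, ?_⟩
      · simpa [hu] using hs.1
      · intro g hg h hh hgh
        rcases Finset.mem_insert.1 hg with rfl | hg'
        · rcases Finset.mem_insert.1 hh with rfl | hh'
          · exact absurd rfl hgh
          · exact (hcon h hh').le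
        · rcases Finset.mem_insert.1 hh with rfl | hh'
          · rw [norm_sub_rev]
            exact (hcon g hg').le
          · exact hs.2 g hg' h hh' hgh
    have := le_csSup hbdd (show (insert u s).card ∈ S from ⟨_, hQ, rfl⟩)
    rw [Finset.card_insert_of_notMem hus, hsc] at this
    omega
  · calc (1 + 2 / ε) ^ Module.finrank ℝ E ≤ Real.exp (2 / ε) ^ Module.finrank ℝ E := by
          gcongr
          linarith [Real.add_one_le_exp (2 / ε)]
      _ = Real.exp (2 * Module.finrank ℝ E / ε) := by
          rw [← Real.exp_nat_mul]
          ring_nf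

end Net

/-! ### From a net to the ball: norms, convex hulls, convex functions. -/

section Inner

variable {E : Type*} [NormedAddCommGroup E] [InnerProductSpace ℝ E]

/-- The vector R v/‖v‖ has inner product R‖v‖ with v, and moving to a net point loses at most half
of it. -/
theorem norm_le_of_net {R : ℝ} (hR : 0 < R) {s : Finset E}
    (hnet : ∀ u : E, ‖u‖ ≤ R → ∃ g ∈ s, ‖u - g‖ ≤ 1 / 2 * R) {v : E} {c : ℝ}
    (hv : ∀ g ∈ s, inner ℝ v g ≤ c) : R * ‖v‖ ≤ 2 * c := by
  by_cases hv0 : v = 0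
  · obtain ⟨g, hg, -⟩ := hnet 0 (by simpa using hR.le)
    have := hv g hg
    simp only [hv0, inner_zero_left] at this
    simp [hv0, this]
  have hvn : 0 < ‖v‖ := norm_pos_iff.2 hv0
  obtain ⟨g, hg, hug⟩ := hnet ((R / ‖v‖) • v) (by
    rw [norm_smul, Real.norm_of_nonneg (by positivity)]
    field_simp
    exact le_rfl)
  have h1 : inner ℝ v ((R / ‖v‖) • v) = R * ‖v‖ := by
    rw [inner_smul_right, real_inner_self_eq_norm_sq]
    field_simp
  have h2 : inner ℝ v ((R / ‖v‖) • v - g) ≤ ‖v‖ * (1 / 2 * R) :=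
    (real_inner_le_norm _ _).trans (by gcongr)
  rw [inner_sub_right, h1] at h2
  linarith [hv g hg]

/-- A functional separating u from the hull would be bounded on the net, hence by `norm_le_of_net`
too small in norm to exceed that bound at u. -/
theorem mem_convexHull_of_net [FiniteDimensional ℝ E] {R : ℝ} (hR : 0 < R) {s : Finset E}
    (hnet : ∀ u : E, ‖u‖ ≤ R → ∃ g ∈ s, ‖u - g‖ ≤ 1 / 2 * R) {u : E} (hu : ‖u‖ ≤ R / 2) :
    u ∈ convexHull ℝ (s : Set E) := by
  by_contra hcon
  have hclosed : IsClosed (convexHull ℝ (s : Set E)) :=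
    (Set.Finite.isCompact_convexHull (𝕜 := ℝ) s.finite_toSet).isClosed
  obtain ⟨φ, c, hφ, hc⟩ := geometric_hahn_banach_closed_point (convex_convexHull ℝ _) hclosed hcon
  obtain ⟨v, rfl⟩ := (InnerProductSpace.toDual ℝ E).surjective φ
  simp only [InnerProductSpace.toDual_apply_apply] at hφ hc
  have h1 := norm_le_of_net hR hnet (v := v) (c := c)
    fun g hg => (hφ g (subset_convexHull ℝ _ hg)).le
  have h2 : inner ℝ v u ≤ ‖v‖ * (R / 2) := (real_inner_le_norm _ _).trans (by gcongr)
  linarith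

/-- A nonnegative convex function which is bounded on a net of a ball is Lipschitz on a smaller
ball. -/
theorem abs_sub_le_of_net [FiniteDimensional ℝ E] {R M : ℝ} (hR : 0 < R) (hM : 0 ≤ M)
    {s : Finset E} (hnet : ∀ u : E, ‖u‖ ≤ R → ∃ g ∈ s, ‖u - g‖ ≤ 1 / 2 * R) {f : E → ℝ}
    (hf : ConvexOn ℝ Set.univ f) (hf0 : ∀ u, 0 ≤ f u) (hfM : ∀ g ∈ s, f g ≤ M) {u w : E}
    (hu : ‖u‖ < 3 * R / 8) (hw : ‖w‖ < 3 * R / 8) : |f u - f w| ≤ 16 * M / R * ‖u - w‖ := by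
  have hbd : ∀ z : E, dist z 0 < R / 2 → |f z| ≤ M := fun z hz => by
    rw [dist_zero_right] at hz
    obtain ⟨g, hg, hzg⟩ := hf.exists_ge_of_mem_convexHull (Set.subset_univ _)
      (mem_convexHull_of_net hR hnet hz.le)
    rw [abs_of_nonneg (hf0 z)]
    exact hzg.trans (hfM g hg)
  -- On the ball of radius R/2 the function lies in [0, M]. Giving up a margin R/8 yields the
  -- Lipschitz constant 2M/(R/8).
  have hL := (hf.subset (Set.subset_univ _) (convex_ball (0 : E) (R / 2))).lipschitzOnWith_of_abs_le
    (ε := R / 8) (by positivity) hbd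
  have := hL.dist_le_mul u (by rw [mem_ball_zero_iff]; linarith) w
    (by rw [mem_ball_zero_iff]; linarith)
  rw [Real.dist_eq, dist_eq_norm, Real.coe_toNNReal _ (by positivity)] at this
  convert this using 2
  field_simp
  ring

end Inner

/-! ### The first order remainder of the absolute value. -/

/-- The sign of a real number, with value `-1` at the origin. -/
def sgn (e : ℝ) : ℝ := if 0 < e then 1 else -1

/-- The remainder of the first order expansion of `t ↦ |e - t| / 2` at `t = 0`. -/
def rem (t e : ℝ) : ℝ := 1 / 2 * (|e - t| - |e| + t * sgn e)

theorem measurable_sgn : Measurable sgn :=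
  Measurable.ite measurableSet_Ioi measurable_const measurable_const

theorem abs_sgn (e : ℝ) : |sgn e| = 1 := by
  unfold sgn
  split_ifs <;> simp

theorem measurable_rem (t : ℝ) : Measurable (rem t) := by
  unfold rem
  have := measurable_sgn
  fun_prop

/-- The remainder sees only residuals whose sign is changed by the shift t. The choice `sgn 0 = -1`
is what makes the interval open at 0 here and closed at 0 for t ≤ 0. -/
theorem rem_eq_indicator_of_nonneg {t : ℝ} (ht : 0 ≤ t) :
    rem t = (Set.Ioc 0 t).indicator fun e => t - e := by
  ext e
  unfold rem sgn
  rw [Set.indicator_apply]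
  simp only [Set.mem_Ioc]
  split_ifs <;> grind

theorem rem_eq_indicator_of_nonpos {t : ℝ} (ht : t ≤ 0) :
    rem t = (Set.Ioc t 0).indicator fun e => e - t := by
  ext e
  unfold rem sgn
  rw [Set.indicator_apply]
  simp only [Set.mem_Ioc]
  split_ifs <;> grind

theorem rem_nonneg (t e : ℝ) : 0 ≤ rem t e := by
  unfold rem sgn
  split_ifs <;> grind

theorem rem_le (t e : ℝ) : rem t e ≤ |t| := by
  unfold rem sgn
  split_ifs <;> grind

theorem abs_rem_le (t e : ℝ) : |rem t e| ≤ |t| := by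
  rw [abs_of_nonneg (rem_nonneg t e)]
  exact rem_le t e

theorem rem_eq_zero {t e : ℝ} (h : |t| < |e|) : rem t e = 0 := by
  unfold rem sgn
  split_ifs <;> grind

theorem integral_rem_volume (t : ℝ) : ∫ e, rem t e = t ^ 2 / 2 := by
  rcases le_total 0 t with ht | ht
  · rw [rem_eq_indicator_of_nonneg ht, integral_indicator measurableSet_Ioc,
      ← intervalIntegral.integral_of_le ht]
    rw [intervalIntegral.integral_sub intervalIntegrable_const
      intervalIntegral.intervalIntegrable_id, integral_id, intervalIntegral.integral_const,
      smul_eq_mul]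
    ring
  · rw [rem_eq_indicator_of_nonpos ht, integral_indicator measurableSet_Ioc,
      ← intervalIntegral.integral_of_le ht]
    rw [intervalIntegral.integral_sub intervalIntegral.intervalIntegrable_id
      intervalIntegrable_const, integral_id, intervalIntegral.integral_const, smul_eq_mul]
    ring

theorem integrable_rem_volume (t : ℝ) : Integrable (rem t) := by
  rcases le_total 0 t with ht | ht
  · rw [rem_eq_indicator_of_nonneg ht, integrable_indicator_iff measurableSet_Ioc]
    exact (Continuous.integrableOn_Icc (by fun_prop)).mono_set Set.Ioc_subset_Icc_self
  · rw [rem_eq_indicator_of_nonpos ht, integrable_indicator_iff measurableSet_Ioc]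
    exact (Continuous.integrableOn_Icc (by fun_prop)).mono_set Set.Ioc_subset_Icc_self

theorem convexOn_rem (e : ℝ) : ConvexOn ℝ Set.univ fun t => rem t e := by
  refine ⟨convex_univ, fun x _ y _ a b ha hb hab => ?_⟩
  simp only [rem, smul_eq_mul]
  have h1 : |e - (a * x + b * y)| ≤ a * |e - x| + b * |e - y| := by
    have : e - (a * x + b * y) = a * (e - x) + b * (e - y) := by linear_combination (-e) * hab
    rw [this]
    refine (abs_add_le _ _).trans ?_
    rw [abs_mul, abs_mul, abs_of_nonneg ha, abs_of_nonneg hb]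
  have h2 : |e| = a * |e| + b * |e| := by rw [← add_mul, hab, one_mul]
  linarith

/-! ### Moments of the remainder under a bounded density. -/

section Density

variable {d : ℝ → ℝ} {C : ℝ}

theorem withDensity_real_Icc_le (hC : 0 ≤ C) (hdC : ∀ u, d u ≤ C) {τ : ℝ} (hτ : 0 ≤ τ) :
    (volume.withDensity fun u => ENNReal.ofReal (d u)).real (Set.Icc (-τ) τ) ≤ 2 * C * τ := by
  have h : (volume.withDensity fun u => ENNReal.ofReal (d u)) (Set.Icc (-τ) τ)
      ≤ ENNReal.ofReal (2 * C * τ) := by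
    rw [withDensity_apply _ measurableSet_Icc]
    calc ∫⁻ u in Set.Icc (-τ) τ, ENNReal.ofReal (d u)
        ≤ ∫⁻ _u in Set.Icc (-τ) τ, ENNReal.ofReal C :=
          lintegral_mono fun u => ENNReal.ofReal_le_ofReal (hdC u)
      _ = ENNReal.ofReal (2 * C * τ) := by
          rw [setLIntegral_const, Real.volume_Icc, ← ENNReal.ofReal_mul hC]
          ring_nf
  exact ENNReal.toReal_le_of_le_ofReal (by positivity) h

/-- The remainder vanishes for |e| > |t|, so only values of the density within ρ of 0 enter, and
there it may be replaced by `d 0` at relative cost δ. -/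
theorem abs_integral_rem_sub_le (hd : Measurable d) (hd0 : ∀ u, 0 ≤ d u) (hdC : ∀ u, d u ≤ C)
    (hpos : 0 < d 0) {ρ δ : ℝ} (hδ : ∀ u, |u| ≤ ρ → |d u / d 0 - 1| ≤ δ) {t : ℝ} (ht : |t| ≤ ρ) :
    |∫ e, rem t e ∂(volume.withDensity fun u => ENNReal.ofReal (d u)) - d 0 * t ^ 2 / 2|
      ≤ δ * (d 0 * t ^ 2 / 2) := by
  have h1 : ∫ e, rem t e ∂(volume.withDensity fun u => ENNReal.ofReal (d u))
      = ∫ e, d e * rem t e := by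
    rw [integral_withDensity_eq_integral_toReal_smul hd.ennreal_ofReal
      (Eventually.of_forall fun _ => ENNReal.ofReal_lt_top)]
    simp only [ENNReal.toReal_ofReal (hd0 _), smul_eq_mul]
  have hint : Integrable fun e => d e * rem t e :=
    (integrable_rem_volume t).bdd_mul hd.aestronglyMeasurable
      (Eventually.of_forall fun u => by rw [Real.norm_of_nonneg (hd0 u)]; exact hdC u)
  have h2 : d 0 * t ^ 2 / 2 = ∫ e, d 0 * rem t e := by
    rw [integral_const_mul, integral_rem_volume]
    ring
  rw [h1]
  nth_rw 1 [h2]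
  rw [← integral_sub hint ((integrable_rem_volume t).const_mul _), ← Real.norm_eq_abs]
  have h3 : δ * (d 0 * t ^ 2 / 2) = ∫ e, δ * d 0 * rem t e := by
    rw [integral_const_mul, integral_rem_volume]
    ring
  rw [h3]
  refine norm_integral_le_of_norm_le ((integrable_rem_volume t).const_mul _)
    (Eventually.of_forall fun e => ?_)
  rw [← sub_mul, Real.norm_eq_abs, abs_mul, abs_of_nonneg (rem_nonneg t e)]
  rcases le_or_gt |e| ρ with he | he
  · refine mul_le_mul_of_nonneg_right ?_ (rem_nonneg t e)
    have h4 : d e - d 0 = (d e / d 0 - 1) * d 0 := by field_simp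
    rw [h4, abs_mul, abs_of_pos hpos]
    exact mul_le_mul_of_nonneg_right (hδ e he) hpos.le
  · rw [rem_eq_zero (ht.trans_lt he), mul_zero, mul_zero]

variable [IsProbabilityMeasure (volume.withDensity fun u => ENNReal.ofReal (d u))]

/-- The remainder is at most |t| and vanishes outside [-|t|, |t|], which has probability at most
2C|t|. The case k = 2 yields the small variance, and k = 1 the quadratic mean. -/
theorem integral_pow_rem_le (hC : 0 ≤ C) (hdC : ∀ u, d u ≤ C) (t : ℝ) {k : ℕ} (hk : k ≠ 0) :
    ∫ e, rem t e ^ k ∂(volume.withDensity fun u => ENNReal.ofReal (d u))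
      ≤ |t| ^ k * (2 * C * |t|) := by
  set ν := volume.withDensity fun u => ENNReal.ofReal (d u)
  calc ∫ e, rem t e ^ k ∂ν
      ≤ ∫ e, (Set.Icc (-|t|) |t|).indicator (fun _ => |t| ^ k) e ∂ν := by
        refine integral_mono_of_nonneg (Eventually.of_forall fun e => pow_nonneg (rem_nonneg t e) k)
          ((integrable_const _).indicator measurableSet_Icc) (Eventually.of_forall fun e => ?_)
        simp only [Set.indicator_apply, Set.mem_Icc, ← abs_le]
        split_ifs with h
        · exact pow_le_pow_left₀ (rem_nonneg t e) (rem_le t e) k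
        · rw [rem_eq_zero (not_le.1 h), zero_pow hk]
    _ = |t| ^ k * ν.real (Set.Icc (-|t|) |t|) := by
        rw [integral_indicator_const _ measurableSet_Icc, smul_eq_mul, mul_comm]
    _ ≤ _ := by
        gcongr
        exact withDensity_real_Icc_le hC hdC (abs_nonneg t)

/-- A density bounded below by `a ^ 2 / 8` near the origin bounds the width of the neighbourhood. -/
theorem rho_mul_le_four {ρ δ a : ℝ} (hδ2 : δ < 1 / 2) (ha : 0 < a)
    (hda : a ^ 2 / 4 ≤ d 0) (hδ : ∀ u, |u| ≤ ρ → |d u / d 0 - 1| ≤ δ) : ρ * a ^ 2 ≤ 4 := by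
  set ν := volume.withDensity fun u => ENNReal.ofReal (d u) with hν
  have hpos : 0 < d 0 := lt_of_lt_of_le (by positivity) hda
  have h : ENNReal.ofReal (a ^ 2 / 8 * (2 * ρ)) ≤ 1 := by
    calc ENNReal.ofReal (a ^ 2 / 8 * (2 * ρ))
        = ∫⁻ _u in Set.Icc (-ρ) ρ, ENNReal.ofReal (a ^ 2 / 8) := by
          rw [setLIntegral_const, Real.volume_Icc, ← ENNReal.ofReal_mul (by positivity)]
          ring_nf
      _ ≤ ∫⁻ u in Set.Icc (-ρ) ρ, ENNReal.ofReal (d u) := by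
          refine setLIntegral_mono' measurableSet_Icc fun u hu => ENNReal.ofReal_le_ofReal ?_
          have h1 := (abs_le.1 (hδ u (abs_le.2 hu))).1
          have h2 : 1 / 2 ≤ d u / d 0 := by linarith
          rw [le_div_iff₀ hpos] at h2
          linarith
      _ = ν (Set.Icc (-ρ) ρ) := by rw [hν, withDensity_apply _ measurableSet_Icc]
      _ ≤ 1 := prob_le_one
  rw [ENNReal.ofReal_le_one] at h
  linarith

end Density

/-! ### Deterministic analysis of a nearly quadratic concave problem. -/

section Deterministic

variable {E : Type*} [NormedAddCommGroup E] [InnerProductSpace ℝ E]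

/-- The quadratic approximation of a convex function extends from a net to a ball. -/
theorem quadratic_approx_of_net [FiniteDimensional ℝ E] {R ε τ δ : ℝ} (hR : 0 < R) (hε : 0 < ε)
    (hε16 : ε ≤ 1 / 16) (hτ : 0 ≤ τ) (hδ0 : 0 ≤ δ) (hδ : δ < 1 / 2) {s : Finset E}
    (hs : ∀ g ∈ s, ‖g‖ ≤ R) (hnet : ∀ u : E, ‖u‖ ≤ R → ∃ g ∈ s, ‖u - g‖ ≤ ε * R)
    {f G : E → ℝ} (hf : ConvexOn ℝ Set.univ f) (hf0 : ∀ u, 0 ≤ f u)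
    (hfG : ∀ g ∈ s, |f g - G g| ≤ τ) (hG : ∀ g ∈ s, |G g - ‖g‖ ^ 2 / 2| ≤ δ * (‖g‖ ^ 2 / 2))
    {u : E} (hu : ‖u‖ ≤ R / 4) :
    |f u - ‖u‖ ^ 2 / 2| ≤ δ / 2 * ‖u‖ ^ 2 + (16 * (R ^ 2 + τ) * ε + τ + ε * R ^ 2) := by
  have hfM : ∀ g ∈ s, f g ≤ R ^ 2 + τ := fun g hg => by
    have h1 := (abs_le.1 (hfG g hg)).2
    have h2 := (abs_le.1 (hG g hg)).2
    have h3 : ‖g‖ ^ 2 ≤ R ^ 2 := pow_le_pow_left₀ (norm_nonneg _) (hs g hg) 2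
    nlinarith [sq_nonneg ‖g‖]
  obtain ⟨g, hg, hug⟩ := hnet u (by linarith)
  have hgn : ‖g‖ ≤ ‖u‖ + ε * R := by
    have := norm_sub_norm_le g u
    rw [norm_sub_rev] at this
    linarith
  have hun : ‖u‖ ≤ ‖g‖ + ε * R := by
    have := norm_sub_norm_le u g
    linarith
  have hεR : ε * R ≤ R / 16 := by nlinarith
  have hεR0 : 0 < ε * R := by positivity
  have h1 := abs_sub_le_of_net hR (by positivity : 0 ≤ R ^ 2 + τ)
    (fun z hz => (hnet z hz).imp fun g h => ⟨h.1, h.2.trans (by gcongr; linarith)⟩)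
    hf hf0 hfM (u := u) (w := g) (by linarith) (by linarith)
  have h2 : 16 * (R ^ 2 + τ) / R * ‖u - g‖ ≤ 16 * (R ^ 2 + τ) * ε := by
    calc 16 * (R ^ 2 + τ) / R * ‖u - g‖ ≤ 16 * (R ^ 2 + τ) / R * (ε * R) := by gcongr
      _ = _ := by field_simp
  -- As ‖u‖ ≤ R/4 and ε ≤ 1/16, both the cross term 2εR‖u‖ and the square (εR)² fit into εR².
  have h3 : ‖g‖ ^ 2 ≤ ‖u‖ ^ 2 + ε * R ^ 2 := by
    nlinarith [norm_nonneg u, norm_nonneg g, pow_le_pow_left₀ (norm_nonneg g) hgn 2]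
  have h4 : ‖u‖ ^ 2 ≤ ‖g‖ ^ 2 + ε * R ^ 2 := by
    nlinarith [norm_nonneg u, norm_nonneg g, pow_le_pow_left₀ (norm_nonneg u) hun 2]
  have h5 := hfG g hg
  have h6 := hG g hg
  have h7 : 0 ≤ ε * R ^ 2 := by positivity
  have h8 : δ * (‖g‖ ^ 2 / 2) ≤ δ / 2 * ‖u‖ ^ 2 + ε * R ^ 2 / 4 := by
    nlinarith
  rw [abs_le] at h1 h5 h6 ⊢
  constructor <;> linarith [h1.1, h1.2, h5.1, h5.2, h6.1, h6.2]

/-- The maximizer and the maximum of a concave function close to a quadratic one. -/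
theorem maximizer_of_quadratic_approx {f : E → ℝ} (hf : ConvexOn ℝ Set.univ f) (hf00 : f 0 = 0)
    {ξ : E} {r δ w : ℝ} (hr : 0 < r) (hδ0 : 0 ≤ δ) (hδ : δ < 1 / 2)
    (hfq : ∀ u, ‖u‖ ≤ r → |f u - ‖u‖ ^ 2 / 2| ≤ δ / 2 * ‖u‖ ^ 2 + w) (hξ : ‖ξ‖ ≤ r)
    (hsmall : ‖ξ‖ * r + w < r ^ 2 / 4) {v : E}
    (hv : ∀ u, inner ℝ ξ u - f u ≤ inner ℝ ξ v - f v) :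
    ‖v - ξ‖ ^ 2 ≤ 4 * (δ / 2 * r ^ 2 + w) ∧
      |2 * (inner ℝ ξ v - f v) - ‖ξ‖ ^ 2| ≤ 2 * (δ / 2 * r ^ 2 + w) := by
  have hunif : ∀ u, ‖u‖ ≤ r → |f u - ‖u‖ ^ 2 / 2| ≤ δ / 2 * r ^ 2 + w := fun u hu =>
    (hfq u hu).trans (by gcongr)
  -- If v lay outside, its rescaling to the sphere of radius r would still have a nonnegative
  -- objective by concavity. On that sphere f ≥ (1 - δ)r²/2 - w ≥ r²/4 - w > ‖ξ‖r, a contradiction.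
  have hvr : ‖v‖ ≤ r := by
    by_contra! hcon
    have hv0 : 0 < ‖v‖ := hr.trans hcon
    set c := r / ‖v‖ with hc
    have hc0 : 0 < c := by positivity
    have hc1 : c ≤ 1 := by
      rw [hc, div_le_one hv0]
      exact hcon.le
    have hcv : ‖c • v‖ = r := by
      rw [norm_smul, Real.norm_of_nonneg hc0.le, hc]
      field_simp
    have h1 : f (c • v) ≤ c * f v := by
      have := hf.2 (Set.mem_univ v) (Set.mem_univ 0) hc0.le (sub_nonneg.2 hc1) (by ring)
      simpa [hf00] using this
    have h2 : 0 ≤ inner ℝ ξ v - f v := by simpa [hf00] using hv 0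
    have h3 : 0 ≤ inner ℝ ξ (c • v) - f (c • v) := by
      rw [inner_smul_right]
      nlinarith
    have h4 : inner ℝ ξ (c • v) ≤ ‖ξ‖ * r := hcv ▸ real_inner_le_norm _ _
    have h5 := (abs_le.1 (hfq (c • v) hcv.le)).1
    rw [hcv] at h5
    nlinarith [sq_nonneg r]
  -- Complete the square and compare v with the competitor ξ: the quadratic approximation is used
  -- once at each point.
  have e1 := abs_le.1 (hunif v hvr)
  have e2 := abs_le.1 (hunif ξ hξ)
  have e3 := hv ξ
  rw [real_inner_self_eq_norm_sq] at e3
  have e4 : ‖v - ξ‖ ^ 2 = ‖v‖ ^ 2 - 2 * inner ℝ ξ v + ‖ξ‖ ^ 2 := by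
    rw [norm_sub_sq_real, real_inner_comm]
  have e5 := sq_nonneg ‖v - ξ‖
  refine ⟨by linarith [e1.1, e2.2], abs_le.2 ⟨by linarith [e2.2], ?_⟩⟩
  rw [e4] at e5
  linarith [e1.1]

end Deterministic

/-! ### The exact split of the log-likelihood into score and remainder. -/

section Score

variable {n p : ℕ} (α : Fin n → EuclideanSpace ℝ (Fin p))

/-- The normalized score, for the residuals `e`. -/
def scoreSum (e : Fin n → ℝ) : EuclideanSpace ℝ (Fin p) :=
  (1 / 2 : ℝ) • ∑ i, sgn (e i) • α i

/-- The remainder of the first order expansion of the log-likelihood, for the residuals `e`. -/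
def remSum (e : Fin n → ℝ) (u : EuclideanSpace ℝ (Fin p)) : ℝ :=
  ∑ i, rem (inner ℝ (α i) u) (e i)

theorem inner_scoreSum (e : Fin n → ℝ) (u : EuclideanSpace ℝ (Fin p)) :
    inner ℝ (scoreSum α e) u = ∑ i, 1 / 2 * (sgn (e i) * inner ℝ (α i) u) := by
  simp [scoreSum, inner_smul_left, sum_inner, Finset.mul_sum]

theorem remSum_nonneg (e : Fin n → ℝ) (u : EuclideanSpace ℝ (Fin p)) : 0 ≤ remSum α e u :=
  Finset.sum_nonneg fun _ _ => rem_nonneg _ _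

theorem remSum_zero (e : Fin n → ℝ) : remSum α e 0 = 0 := by
  simp [remSum, rem]

theorem convexOn_remSum (e : Fin n → ℝ) : ConvexOn ℝ Set.univ (remSum α e) := by
  refine ⟨convex_univ, fun u _ w _ c d hc hd hcd => ?_⟩
  simp only [remSum, smul_eq_mul, Finset.mul_sum]
  rw [← Finset.sum_add_distrib]
  refine Finset.sum_le_sum fun i _ => ?_
  have := (convexOn_rem (e i)).2 (Set.mem_univ (inner ℝ (α i) u)) (Set.mem_univ (inner ℝ (α i) w))
    hc hd hcd
  simpa [inner_add_right, inner_smul_right] using this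

theorem logLik_sub_eq (y : Fin n → ℝ) (θ θs : EuclideanSpace ℝ (Fin p))
    (Ψ : Fin n → EuclideanSpace ℝ (Fin p)) :
    logLik Ψ y θ - logLik Ψ y θs
      = inner ℝ (scoreSum Ψ fun i => y i - inner ℝ (Ψ i) θs) (θ - θs)
        - remSum Ψ (fun i => y i - inner ℝ (Ψ i) θs) (θ - θs) := by
  rw [inner_scoreSum, logLik, logLik, remSum, Finset.mul_sum, Finset.mul_sum,
    ← Finset.sum_sub_distrib, ← Finset.sum_sub_distrib]
  refine Finset.sum_congr rfl fun i _ => ?_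
  rw [rem, inner_sub_right]
  ring_nf

end Score

/-! ### Uniform tail bounds over the nets. -/

section Tail

variable {Ω : Type*} [MeasurableSpace Ω] {P : Measure Ω}

/-- The spare 1 in the exponent supplies e⁻¹ < 1/2, so that two such events together cost at most
e⁻ˣ. -/
theorem measureReal_biUnion_le_half_exp {ι : Type*} {s : Finset ι} {B : ι → Set Ω} {m c x : ℝ}
    (hs : (s.card : ℝ) ≤ Real.exp m) (hB : ∀ g ∈ s, P.real (B g) ≤ Real.exp (-c))
    (hc : x + 1 + m ≤ c) : P.real (⋃ g ∈ s, B g) ≤ 1 / 2 * Real.exp (-x) := by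
  calc P.real (⋃ g ∈ s, B g) ≤ ∑ g ∈ s, P.real (B g) := measureReal_biUnion_finset_le _ _
    _ ≤ ∑ _g ∈ s, Real.exp (-c) := Finset.sum_le_sum hB
    _ = s.card * Real.exp (-c) := by simp
    _ ≤ Real.exp m * Real.exp (-c) := by gcongr
    _ = Real.exp (m - c) := by rw [← Real.exp_add]; ring_nf
    _ ≤ Real.exp (-1 + -x) := Real.exp_le_exp.2 (by linarith)
    _ = Real.exp (-1) * Real.exp (-x) := Real.exp_add _ _
    _ ≤ 1 / 2 * Real.exp (-x) := by
        gcongr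
        have := Real.exp_neg_one_lt_d9
        linarith

variable [IsProbabilityMeasure P] {n p : ℕ} {α : Fin n → EuclideanSpace ℝ (Fin p)} {e : Fin n → Ω → ℝ} {a b q x : ℝ}

/-- At a net point the variance is at most 1/a². The parameter l = a√q gives the exponent -6q + q =
-5q, which pays for the e^(4p) points. -/
theorem score_tail (he : ∀ i, Measurable (e i)) (hind : iIndepFun e P) (ha : 0 < a) (hx : 0 < x)
    (hp : 0 < p) (hq : q = x + p)
    (hsq : ∀ u, ∑ i, inner ℝ (α i) u ^ 2 ≤ 4 * ‖u‖ ^ 2 / a ^ 2)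
    (hb0 : 0 ≤ b) (hb : ∀ i u, |inner ℝ (α i) u| ≤ b * ‖u‖) (hbq : b * (a * √q) ≤ 2)
    (hmean : ∀ u, ∑ i, ∫ ω, 1 / 2 * (sgn (e i ω) * inner ℝ (α i) u) ∂P = 0)
    {s : Finset (EuclideanSpace ℝ (Fin p))} (hs : ∀ g ∈ s, ‖g‖ ≤ 1)
    (hcard : (s.card : ℝ) ≤ Real.exp (4 * p)) :
    P.real (⋃ g ∈ s, {ω | 6 * √q / a ≤ inner ℝ (scoreSum α fun i => e i ω) g})
      ≤ 1 / 2 * Real.exp (-x) := by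
  have hp1 : (1 : ℝ) ≤ p := by exact_mod_cast hp
  have hq0 : 0 < q := by linarith
  refine measureReal_biUnion_le_half_exp (c := 5 * q) hcard (fun g hg => ?_) (by linarith)
  have hmX : ∀ t : ℝ, Measurable fun y : ℝ => 1 / 2 * (sgn y * t) := fun t =>
    (measurable_sgn.mul_const t).const_mul _
  have h := upper_tail_sum_le (P := P) (X := fun i ω => 1 / 2 * (sgn (e i ω) * inner ℝ (α i) g))
    (c := b / 2) (l := a * √q) (v := 1 / a ^ 2) (fun i => (hmX _).comp (he i))
    (hind.comp (fun i y => 1 / 2 * (sgn y * inner ℝ (α i) g)) fun i => hmX _)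
    (fun i ω => by
      rw [abs_mul, abs_mul, abs_sgn, abs_of_pos (by norm_num : (0 : ℝ) < 1 / 2)]
      have h1 : b * ‖g‖ ≤ b := mul_le_of_le_one_right hb0 (hs g hg)
      linarith [hb i g])
    (by positivity) (by linarith) ?_ (6 * √q / a)
  · rw [hmean g] at h
    simp only [sub_zero, ← inner_scoreSum α] at h
    refine h.trans (Real.exp_le_exp.2 (le_of_eq ?_))
    field_simp
    rw [Real.sq_sqrt hq0.le]
    ring
  · have h1 : ∀ i, ∫ ω, (1 / 2 * (sgn (e i ω) * inner ℝ (α i) g)) ^ 2 ∂P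
        = inner ℝ (α i) g ^ 2 / 4 := fun i => by
      have : ∀ ω, (1 / 2 * (sgn (e i ω) * inner ℝ (α i) g)) ^ 2 = inner ℝ (α i) g ^ 2 / 4 :=
        fun ω => by
          rw [mul_pow, mul_pow, ← sq_abs (sgn _), abs_sgn]
          ring
      rw [integral_congr_ae (Eventually.of_forall this)]
      simp
    rw [Finset.sum_congr rfl fun i _ => h1 i, ← Finset.sum_div]
    have h2 : ‖g‖ ^ 2 ≤ 1 := pow_le_one₀ (norm_nonneg _) (hs g hg)
    calc (∑ i, inner ℝ (α i) g ^ 2) / 4 ≤ (4 * ‖g‖ ^ 2 / a ^ 2) / 4 := by gcongr; exact hsq g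
      _ ≤ (4 * 1 / a ^ 2) / 4 := by gcongr
      _ = 1 / a ^ 2 := by ring

/-- Since |⟨αᵢ, g⟩| ≤ ε⁴, the total second moment is at most ε⁴ · 8CR²/a². Thus l = ε⁻² costs only
8CR²/a² in the exponent, while the deviation εTq gains Tq/ε. The choice of T leaves at least 4q/ε,
more than the net's 2p/ε. -/
theorem remSum_tail {C ε R T : ℝ} {dens : Fin n → ℝ → ℝ} (he : ∀ i, Measurable (e i))
    (hind : iIndepFun e P)
    (hlaw : ∀ i, P.map (e i) = volume.withDensity fun u => ENNReal.ofReal (dens i u))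
    (hC : 0 < C) (hdC : ∀ i u, dens i u ≤ C) (ha : 0 < a) (hx : 0 < x)
    (hp : 0 < p) (hq : q = x + p)
    (hsq : ∀ u, ∑ i, inner ℝ (α i) u ^ 2 ≤ 4 * ‖u‖ ^ 2 / a ^ 2)
    (hb0 : 0 ≤ b) (hb : ∀ i u, |inner ℝ (α i) u| ≤ b * ‖u‖) (hbR : b * R = ε ^ 4)
    (hε : 0 < ε) (hε1 : ε ≤ 1) (hT : 8 * C * R ^ 2 / a ^ 2 + 4 * q = T * q)
    {s : Finset (EuclideanSpace ℝ (Fin p))} (hs : ∀ g ∈ s, ‖g‖ ≤ R)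
    (hcard : (s.card : ℝ) ≤ Real.exp (2 * p / ε)) :
    P.real (⋃ g ∈ s, {ω | ε * T * q ≤ |remSum α (fun i => e i ω) g
        - ∑ i, ∫ ω', rem (inner ℝ (α i) g) (e i ω') ∂P|}) ≤ 1 / 2 * Real.exp (-x) := by
  have hp1 : (1 : ℝ) ≤ p := by exact_mod_cast hp
  have hq0 : 0 < q := by linarith
  have hprob : ∀ i, IsProbabilityMeasure
      (volume.withDensity fun u => ENNReal.ofReal (dens i u)) := fun i =>
    hlaw i ▸ Measure.isProbabilityMeasure_map (he i).aemeasurable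
  -- The -1 pays for the two-sided bound, through 2 ≤ e.
  refine measureReal_biUnion_le_half_exp (c := T * q / ε - 8 * C * R ^ 2 / a ^ 2 - 1) hcard
    (fun g hg => ?_) ?_
  · have hR0 : 0 ≤ R := (norm_nonneg g).trans (hs g hg)
    have hX : ∀ i, Measurable fun ω => rem (inner ℝ (α i) g) (e i ω) := fun i =>
      (measurable_rem _).comp (he i)
    have hXi : iIndepFun (fun i ω => rem (inner ℝ (α i) g) (e i ω)) P :=
      hind.comp (fun i y => rem (inner ℝ (α i) g) y) fun i => measurable_rem _
    have ht : ∀ i, |inner ℝ (α i) g| ≤ ε ^ 4 := fun i =>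
      (hb i g).trans (hbR ▸ mul_le_mul_of_nonneg_left (hs g hg) hb0)
    have hXb : ∀ i ω, |rem (inner ℝ (α i) g) (e i ω)| ≤ ε ^ 4 := fun i ω =>
      (abs_rem_le _ _).trans (ht i)
    have hlc : 1 / ε ^ 2 * ε ^ 4 ≤ 1 := by
      have : 1 / ε ^ 2 * ε ^ 4 = ε ^ 2 := by field_simp
      rw [this]
      exact pow_le_one₀ hε.le hε1
    have hv : ∑ i, ∫ ω, rem (inner ℝ (α i) g) (e i ω) ^ 2 ∂P ≤ 8 * C * R ^ 2 / a ^ 2 * ε ^ 4 := by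
      calc ∑ i, ∫ ω, rem (inner ℝ (α i) g) (e i ω) ^ 2 ∂P
          ≤ ∑ i, inner ℝ (α i) g ^ 2 * (2 * C * ε ^ 4) := by
            refine Finset.sum_le_sum fun i _ => ?_
            rw [← integral_map (he i).aemeasurable
              (f := fun y => rem (inner ℝ (α i) g) y ^ 2)
              ((measurable_rem _).pow_const 2).aestronglyMeasurable, hlaw i]
            refine (integral_pow_rem_le hC.le (hdC i) _ two_ne_zero).trans ?_
            rw [sq_abs]
            gcongr
            exact ht i
        _ ≤ (4 * R ^ 2 / a ^ 2) * (2 * C * ε ^ 4) := by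
            rw [← Finset.sum_mul]
            gcongr
            refine (hsq g).trans ?_
            gcongr
            exact hs g hg
        _ = _ := by ring
    have hup := upper_tail_sum_le hX hXi hXb (by positivity) hlc hv (ε * T * q)
    have hlo := lower_tail_sum_le hX hXi hXb (by positivity) hlc hv (ε * T * q)
    have hexp : -(1 / ε ^ 2) * (ε * T * q) + (1 / ε ^ 2) ^ 2 * (8 * C * R ^ 2 / a ^ 2 * ε ^ 4)
        = -(T * q / ε - 8 * C * R ^ 2 / a ^ 2) := by
      field_simp
      ring
    rw [hexp] at hup hlo
    have hsub : {ω | ε * T * q ≤ |remSum α (fun i => e i ω) g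
        - ∑ i, ∫ ω', rem (inner ℝ (α i) g) (e i ω') ∂P|}
        ⊆ {ω | ε * T * q ≤ ∑ i, rem (inner ℝ (α i) g) (e i ω)
            - ∑ i, ∫ ω', rem (inner ℝ (α i) g) (e i ω') ∂P}
          ∪ {ω | ε * T * q ≤ ∑ i, ∫ ω', rem (inner ℝ (α i) g) (e i ω') ∂P
            - ∑ i, rem (inner ℝ (α i) g) (e i ω)} := fun ω hω => by
      rcases le_abs.1 (Set.mem_ofPred_eq ▸ hω) with h | h
      · exact Or.inl h
      · exact Or.inr (by simpa [remSum] using h)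
    refine (measureReal_mono hsub).trans ((measureReal_union_le _ _).trans ?_)
    refine (add_le_add hup hlo).trans ?_
    set c := T * q / ε - 8 * C * R ^ 2 / a ^ 2
    rw [show -(c - 1) = 1 + -c by ring, Real.exp_add]
    have := Real.add_one_le_exp (1 : ℝ)
    nlinarith [Real.exp_pos (-c)]
  · have h1 : T * q / ε = (8 * C * R ^ 2 / a ^ 2 + 4 * q) / ε := by rw [hT]
    have h2 : 8 * C * R ^ 2 / a ^ 2 ≤ 8 * C * R ^ 2 / a ^ 2 / ε :=
      le_div_self (by positivity) hε hε1
    have h3 : x ≤ x / ε := le_div_self hx.le hε hε1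
    have h4 : (p : ℝ) ≤ p / ε := le_div_self (by positivity) hε hε1
    rw [h1, add_div, hq]
    have h5 : 4 * (x + p) / ε = 4 * (x / ε) + 4 * (p / ε) := by ring
    have h6 : 2 * (p : ℝ) / ε = 2 * (p / ε) := by ring
    rw [h5, h6]
    linarith

end Tail

/-! ### The expansion in normalized coordinates. -/

section Main

variable {Ω : Type*} [MeasurableSpace Ω] {P : Measure Ω}

theorem integral_rem_comp {d : ℝ → ℝ} {f : Ω → ℝ} (hf : Measurable f)
    (hlaw : P.map f = volume.withDensity fun u => ENNReal.ofReal (d u)) (t : ℝ) :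
    ∫ ω, rem t (f ω) ∂P = ∫ y, rem t y ∂(volume.withDensity fun u => ENNReal.ofReal (d u)) := by
  rw [← hlaw, integral_map hf.aemeasurable (measurable_rem t).aestronglyMeasurable]

theorem measure_eq_zero_of_law {d : ℝ → ℝ} {f : Ω → ℝ} (hf : Measurable f)
    (hlaw : P.map f = volume.withDensity fun u => ENNReal.ofReal (d u)) :
    P {ω | f ω = 0} = 0 := by
  have h : P {ω | f ω = 0} = P.map f {0} := by
    rw [Measure.map_apply hf (measurableSet_singleton 0)]
    rfl
  rw [h, hlaw]
  exact withDensity_absolutelyContinuous _ _ (by simp)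

variable {n p : ℕ} {α : Fin n → EuclideanSpace ℝ (Fin p)} {e : Fin n → Ω → ℝ} {a b q x : ℝ}

theorem abs_mean_remSum_sub_le {C ρ δ : ℝ} {dens : Fin n → ℝ → ℝ} (he : ∀ i, Measurable (e i))
    (hlaw : ∀ i, P.map (e i) = volume.withDensity fun u => ENNReal.ofReal (dens i u))
    (hd : ∀ i, Measurable (dens i)) (hd0 : ∀ i u, 0 ≤ dens i u) (hdC : ∀ i u, dens i u ≤ C)
    (hpos : ∀ i, 0 < dens i 0) (hδ : ∀ i u, |u| ≤ ρ → |dens i u / dens i 0 - 1| ≤ δ)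
    (hα : ∀ u, ∑ i, dens i 0 * inner ℝ (α i) u ^ 2 = ‖u‖ ^ 2) {u : EuclideanSpace ℝ (Fin p)}
    (hu : ∀ i, |inner ℝ (α i) u| ≤ ρ) :
    |∑ i, ∫ ω, rem (inner ℝ (α i) u) (e i ω) ∂P - ‖u‖ ^ 2 / 2| ≤ δ * (‖u‖ ^ 2 / 2) := by
  rw [← hα u, Finset.sum_div, ← Finset.sum_sub_distrib, Finset.mul_sum]
  refine (Finset.abs_sum_le_sum_abs _ _).trans (Finset.sum_le_sum fun i _ => ?_)
  rw [integral_rem_comp (he i) (hlaw i)]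
  exact abs_integral_rem_sub_le (hd i) (hd0 i) (hdC i) (hpos i) (hδ i) (hu i)

theorem measurable_scoreSum_inner (he : ∀ i, Measurable (e i)) (u : EuclideanSpace ℝ (Fin p)) :
    Measurable fun ω => inner ℝ (scoreSum α fun i => e i ω) u := by
  simp only [inner_scoreSum]
  exact Finset.measurable_sum _ fun i _ => ((measurable_sgn.comp (he i)).mul_const _).const_mul _

theorem measurable_remSum (he : ∀ i, Measurable (e i)) (u : EuclideanSpace ℝ (Fin p)) :
    Measurable fun ω => remSum α (fun i => e i ω) u :=
  Finset.measurable_sum _ fun i _ => (measurable_rem _).comp (he i)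

variable [IsProbabilityMeasure P]

theorem isProbabilityMeasure_of_law {d : ℝ → ℝ} {f : Ω → ℝ} (hf : Measurable f)
    (hlaw : P.map f = volume.withDensity fun u => ENNReal.ofReal (d u)) :
    IsProbabilityMeasure (volume.withDensity fun u => ENNReal.ofReal (d u)) :=
  hlaw ▸ Measure.isProbabilityMeasure_map hf.aemeasurable

theorem integrable_rem_comp {f : Ω → ℝ} (hf : Measurable f) (t : ℝ) :
    Integrable (fun ω => rem t (f ω)) P :=
  integrable_of_abs_le ((measurable_rem t).comp hf) fun _ => abs_rem_le t _

theorem integrable_half_sgn_mul {f : Ω → ℝ} (hf : Measurable f) (t : ℝ) :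
    Integrable (fun ω => 1 / 2 * (sgn (f ω) * t)) P :=
  ((integrable_of_abs_le (measurable_sgn.comp hf)
    fun ω => (abs_sgn (f ω)).le).mul_const t).const_mul _

/-- The score has mean zero at a maximizer of the expected log-likelihood. -/
theorem mean_score_eq_zero {C : ℝ} {dens : Fin n → ℝ → ℝ} (he : ∀ i, Measurable (e i))
    (hlaw : ∀ i, P.map (e i) = volume.withDensity fun u => ENNReal.ofReal (dens i u))
    (hC : 0 < C) (hdC : ∀ i u, dens i u ≤ C)
    (hmax : ∀ u, ∫ ω, (inner ℝ (scoreSum α fun i => e i ω) u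
      - remSum α (fun i => e i ω) u) ∂P ≤ 0) (u : EuclideanSpace ℝ (Fin p)) :
    ∑ i, ∫ ω, 1 / 2 * (sgn (e i ω) * inner ℝ (α i) u) ∂P = 0 := by
  let m : EuclideanSpace ℝ (Fin p) → ℝ := fun u =>
    ∑ i, ∫ ω, 1 / 2 * (sgn (e i ω) * inner ℝ (α i) u) ∂P
  have hsmul : ∀ (c : ℝ) u, m (c • u) = c * m u := fun c u => by
    simp only [m, Finset.mul_sum]
    refine Finset.sum_congr rfl fun i _ => ?_
    rw [← integral_const_mul]
    refine integral_congr_ae (Eventually.of_forall fun ω => ?_)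
    simp only [inner_smul_right]
    ring
  -- The mean score m is linear in u, but optimality bounds it by the mean remainder, which is
  -- quadratic. Small multiples of u then force m ≤ 0, and -u gives equality.
  have hle : ∀ u, m u ≤ ∑ i, 2 * C * inner ℝ (α i) u ^ 2 := fun u => by
    have h1 := hmax u
    simp only [inner_scoreSum, remSum] at h1
    rw [integral_sub (integrable_finsetSum _ fun i _ => integrable_half_sgn_mul (he i) _)
      (integrable_finsetSum _ fun i _ => integrable_rem_comp (he i) _),
      integral_finsetSum _ fun i _ => integrable_half_sgn_mul (he i) _,
      integral_finsetSum _ fun i _ => integrable_rem_comp (he i) _] at h1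
    refine (sub_nonpos.1 h1).trans (Finset.sum_le_sum fun i _ => ?_)
    have := isProbabilityMeasure_of_law (he i) (hlaw i)
    rw [integral_rem_comp (he i) (hlaw i)]
    have h2 := integral_pow_rem_le hC.le (hdC i) (inner ℝ (α i) u) one_ne_zero
    simp only [pow_one] at h2
    refine h2.trans (le_of_eq ?_)
    rw [← sq_abs]
    ring
  have hnonpos : ∀ u, m u ≤ 0 := fun u => by
    by_contra! hcon
    set B := ∑ i, 2 * C * inner ℝ (α i) u ^ 2 with hB
    have hB0 : 0 ≤ B := Finset.sum_nonneg fun i _ => by positivity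
    have hs : ∀ c : ℝ, c * m u ≤ c ^ 2 * B := fun c => by
      have := hle (c • u)
      rw [hsmul] at this
      refine this.trans (le_of_eq ?_)
      rw [hB, Finset.mul_sum]
      refine Finset.sum_congr rfl fun i _ => ?_
      rw [inner_smul_right]
      ring
    -- Dividing by B + 1 rather than B covers B = 0 and makes the inequality strict.
    have h1 := hs (m u / (B + 1))
    have h2 : m u / (B + 1) * m u = (m u / (B + 1)) ^ 2 * (B + 1) := by field_simp
    have h3 : 0 < (m u / (B + 1)) ^ 2 := by positivity
    rw [h2] at h1
    nlinarith
  have h1 := hnonpos u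
  have h2 := hnonpos ((-1 : ℝ) • u)
  rw [hsmul] at h2
  exact le_antisymm h1 (by linarith)

/-- The Fisher and Wilks expansions in the coordinates in which the information matrix is the
identity. -/
theorem normalized_expansion {C ε ρ δ T W : ℝ} {dens : Fin n → ℝ → ℝ}
    (he : ∀ i, Measurable (e i)) (hind : iIndepFun e P)
    (hlaw : ∀ i, P.map (e i) = volume.withDensity fun u => ENNReal.ofReal (dens i u))
    (hd : ∀ i, Measurable (dens i)) (hd0 : ∀ i u, 0 ≤ dens i u) (hC : 0 < C)
    (hdC : ∀ i u, dens i u ≤ C) (hpos : ∀ i, 0 < dens i 0) (hδ0 : 0 ≤ δ) (hδ2 : δ < 1 / 2)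
    (hδ : ∀ i u, |u| ≤ ρ → |dens i u / dens i 0 - 1| ≤ δ) (ha : 0 < a) (hx : 0 < x)
    (hp : 0 < p) (hq : q = x + p)
    (hα : ∀ u, ∑ i, dens i 0 * inner ℝ (α i) u ^ 2 = ‖u‖ ^ 2)
    (hsq : ∀ u, ∑ i, inner ℝ (α i) u ^ 2 ≤ 4 * ‖u‖ ^ 2 / a ^ 2)
    (hb0 : 0 ≤ b) (hb : ∀ i u, |inner ℝ (α i) u| ≤ b * ‖u‖) (hbq : b * (a * √q) ≤ 2)
    (hmean : ∀ u, ∑ i, ∫ ω, 1 / 2 * (sgn (e i ω) * inner ℝ (α i) u) ∂P = 0)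
    (hbR : b * (400 * √q / a) = ε ^ 4) (hbρ : b * (400 * √q / a) ≤ ρ)
    (hT : T = 8 * C * 160000 / a ^ 4 + 4) (hW : W = 17 * (160000 / a ^ 2) + 17 * T)
    (hε : 0 < ε) (hε16 : ε ≤ 1 / 16) (hεW : ε * W ≤ 1 / a ^ 2) :
    ∃ A : Set Ω, MeasurableSet A ∧ 1 - Real.exp (-x) ≤ P.real A ∧
      ∀ ω ∈ A, (∀ i, e i ω ≠ 0) ∧ ∀ v,
        (∀ u, inner ℝ (scoreSum α fun i => e i ω) u - remSum α (fun i => e i ω) u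
          ≤ inner ℝ (scoreSum α fun i => e i ω) v - remSum α (fun i => e i ω) v) →
        ‖v - scoreSum α fun i => e i ω‖ ^ 2 ≤ 4 * ((5000 * δ / a ^ 2 + ε * W) * q) ∧
        |2 * (inner ℝ (scoreSum α fun i => e i ω) v - remSum α (fun i => e i ω) v)
          - ‖scoreSum α fun i => e i ω‖ ^ 2| ≤ 2 * ((5000 * δ / a ^ 2 + ε * W) * q) := by
  have hp1 : (1 : ℝ) ≤ p := by exact_mod_cast hp
  have hq0 : 0 < q := by linarith
  have hT0 : 0 < T := by rw [hT]; positivity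
  set R := 400 * √q / a with hR
  have hR0 : 0 < R := by positivity
  have hR2 : R ^ 2 = 160000 * q / a ^ 2 := by
    rw [hR, div_pow, mul_pow, Real.sq_sqrt hq0.le]
    norm_num
  obtain ⟨s₁, hs₁, hnet₁, hcard₁⟩ :=
    exists_net_closedBall (E := EuclideanSpace ℝ (Fin p)) one_pos (half_pos one_pos)
  obtain ⟨s₂, hs₂, hnet₂, hcard₂⟩ :=
    exists_net_closedBall (E := EuclideanSpace ℝ (Fin p)) hR0 hε
  rw [finrank_euclideanSpace_fin] at hcard₁ hcard₂
  set B₁ : Set Ω := ⋃ g ∈ s₁, {ω | 6 * √q / a ≤ inner ℝ (scoreSum α fun i => e i ω) g} with hB₁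
  set B₂ : Set Ω := ⋃ g ∈ s₂, {ω | ε * T * q ≤ |remSum α (fun i => e i ω) g
        - ∑ i, ∫ ω', rem (inner ℝ (α i) g) (e i ω') ∂P|} with hB₂
  -- Off this null event no residual vanishes, so L is differentiable at θ*.
  set B₀ : Set Ω := ⋃ i, {ω | e i ω = 0} with hB₀
  have hmB₁ : MeasurableSet B₁ := Finset.measurableSet_biUnion _ fun g _ =>
    measurableSet_le measurable_const (measurable_scoreSum_inner he g)
  have hmB₂ : MeasurableSet B₂ := Finset.measurableSet_biUnion _ fun g _ =>
    measurableSet_le measurable_const ((measurable_remSum he g).sub_const _).abs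
  have hmB₀ : MeasurableSet B₀ := MeasurableSet.iUnion fun i =>
    he i (measurableSet_singleton 0)
  have hP₁ : P.real B₁ ≤ 1 / 2 * Real.exp (-x) :=
    score_tail he hind ha hx hp hq hsq hb0 hb hbq hmean hs₁
      (hcard₁.trans (Real.exp_le_exp.2 (by linarith)))
  have hP₂ : P.real B₂ ≤ 1 / 2 * Real.exp (-x) :=
    remSum_tail he hind hlaw hC hdC ha hx hp hq hsq hb0 hb hbR hε (by linarith)
      (by rw [hT, hR2]; field_simp) hs₂ hcard₂
  have hP₀ : P.real B₀ = 0 := by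
    rw [measureReal_def, measure_iUnion_null fun i => measure_eq_zero_of_law (he i) (hlaw i),
      ENNReal.toReal_zero]
  have hmB : MeasurableSet (B₀ ∪ (B₁ ∪ B₂)) := hmB₀.union (hmB₁.union hmB₂)
  refine ⟨(B₀ ∪ (B₁ ∪ B₂))ᶜ, hmB.compl, ?_, fun ω hω => ?_⟩
  · rw [probReal_compl_eq_one_sub hmB]
    have h1 := measureReal_union_le (μ := P) B₀ (B₁ ∪ B₂)
    have h2 := measureReal_union_le (μ := P) B₁ B₂
    linarith
  · simp only [Set.mem_compl_iff, Set.mem_union, not_or] at hω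
    obtain ⟨hω₀, hω₁, hω₂⟩ := hω
    simp only [hB₀, hB₁, hB₂, Set.mem_iUnion, Set.mem_ofPred_eq, not_exists, not_le]
      at hω₀ hω₁ hω₂
    refine ⟨hω₀, fun v hv => ?_⟩
    set ξ := scoreSum α fun i => e i ω with hξ
    have hξn : ‖ξ‖ ≤ 12 * √q / a := by
      have := norm_le_of_net one_pos (s := s₁) hnet₁ (v := ξ) (c := 6 * √q / a)
        fun g hg => (hω₁ g hg).le
      rw [one_mul] at this
      exact this.trans (le_of_eq (by ring))
    have hεW' : ε * W * q ≤ q / a ^ 2 := by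
      calc ε * W * q ≤ 1 / a ^ 2 * q := by gcongr
        _ = q / a ^ 2 := by ring
    -- One of the two factors ε in 16ε²Tq is dropped. Hence both coefficients in W are 16 + 1.
    have hw : 16 * (R ^ 2 + ε * T * q) * ε + ε * T * q + ε * R ^ 2 ≤ ε * W * q := by
      have h1 : ε * (T * q) * ε ≤ ε * (T * q) := mul_le_of_le_one_right (by positivity) (by linarith)
      have h2 : ε * W * q = 17 * (ε * R ^ 2) + 17 * (ε * (T * q)) := by
        rw [hW, hR2]
        ring
      rw [h2]
      linarith
    have happ : ∀ u : EuclideanSpace ℝ (Fin p), ‖u‖ ≤ R / 4 →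
        |remSum α (fun i => e i ω) u - ‖u‖ ^ 2 / 2| ≤ δ / 2 * ‖u‖ ^ 2 + ε * W * q := fun u hu =>
      (quadratic_approx_of_net hR0 hε hε16 (by positivity) hδ0 hδ2 hs₂ hnet₂
        (convexOn_remSum α _) (remSum_nonneg α _)
        (G := fun g => ∑ i, ∫ ω', rem (inner ℝ (α i) g) (e i ω') ∂P)
        (fun g hg => (hω₂ g hg).le)
        (fun g hg => abs_mean_remSum_sub_le he hlaw hd hd0 hdC hpos hδ hα fun i =>
          (hb i g).trans ((mul_le_mul_of_nonneg_left (hs₂ g hg) hb0).trans hbρ)) hu).trans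
        (by linarith)
    have hr : R / 4 = 100 * √q / a := by
      rw [hR]
      ring
    have hr2 : (R / 4) ^ 2 = 10000 * (q / a ^ 2) := by
      rw [div_pow, hR2]
      ring
    have hqa : 0 < q / a ^ 2 := by positivity
    -- In units of q/a², with r = R/4 = 100√q/a: ‖ξ‖r ≤ 1200 and the error w ≤ 1, against r²/4 =
    -- 2500.
    have hmain := maximizer_of_quadratic_approx (convexOn_remSum α fun i => e i ω)
      (remSum_zero α _) (ξ := ξ) (by positivity) hδ0 hδ2 happ ?_ ?_ hv
    · have hD : δ / 2 * (R / 4) ^ 2 + ε * W * q = (5000 * δ / a ^ 2 + ε * W) * q := by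
        rw [hr2]
        ring
      rwa [hD] at hmain
    · rw [hr]
      refine hξn.trans ?_
      gcongr
      norm_num
    · have h1 : ‖ξ‖ * (R / 4) ≤ 12 * √q / a * (R / 4) := by gcongr
      have h2 : 12 * √q / a * (R / 4) = 1200 * (q / a ^ 2) := by
        rw [hr]
        calc 12 * √q / a * (100 * √q / a) = 1200 * (√q ^ 2 / a ^ 2) := by ring
          _ = _ := by rw [Real.sq_sqrt hq0.le]
      rw [hr2]
      linarith

end Main

/-! ### The gradient of the log-likelihood. -/

section Gradient

variable {n p : ℕ}

/-- Near θ* no residual changes sign, so the remainder vanishes identically and L is affine there.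
-/
theorem gradient_logLik (Ψ : Fin n → EuclideanSpace ℝ (Fin p)) (y : Fin n → ℝ)
    (θs : EuclideanSpace ℝ (Fin p)) (hy : ∀ i, y i - inner ℝ (Ψ i) θs ≠ 0) :
    gradient (logLik Ψ y) θs = scoreSum Ψ fun i => y i - inner ℝ (Ψ i) θs := by
  set S := scoreSum Ψ fun i => y i - inner ℝ (Ψ i) θs with hS
  refine HasGradientAt.gradient ?_
  rw [hasGradientAt_iff_hasFDerivAt]
  have hev : logLik Ψ y =ᶠ[𝓝 θs] fun θ =>
      InnerProductSpace.toDual ℝ _ S θ + (logLik Ψ y θs - inner ℝ S θs) := by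
    have h1 : ∀ᶠ θ in 𝓝 θs, ∀ i, |inner ℝ (Ψ i) (θ - θs)| < |y i - inner ℝ (Ψ i) θs| := by
      refine eventually_all.2 fun i => ?_
      have hc : Continuous fun θ : EuclideanSpace ℝ (Fin p) => |inner ℝ (Ψ i) (θ - θs)| := by
        fun_prop
      refine hc.continuousAt.eventually_lt continuousAt_const ?_
      simpa using hy i
    filter_upwards [h1] with θ hθ
    have h2 := logLik_sub_eq y θ θs Ψ
    have h3 : remSum Ψ (fun i => y i - inner ℝ (Ψ i) θs) (θ - θs) = 0 :=
      Finset.sum_eq_zero fun i _ => rem_eq_zero (hθ i)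
    rw [h3, sub_zero, inner_sub_right] at h2
    rw [InnerProductSpace.toDual_apply_apply]
    linarith
  refine HasFDerivAt.congr_of_eventuallyEq ?_ hev
  exact (InnerProductSpace.toDual ℝ _ S).hasFDerivAt.add_const _

end Gradient

/-! ### The matrices V₀, D₀ and the effective sample size. -/

section Matrices

variable {n p : ℕ}

theorem act_mul (M N : Matrix (Fin p) (Fin p) ℝ) (v : EuclideanSpace ℝ (Fin p)) :
    act M (act N v) = act (M * N) v := by
  simp [act, Matrix.mulVec_mulVec]

theorem act_one (v : EuclideanSpace ℝ (Fin p)) : act 1 v = v := by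
  simp [act]

theorem act_smul_sum (M : Matrix (Fin p) (Fin p) ℝ) (c : ℝ) (s : Fin n → ℝ)
    (v : Fin n → EuclideanSpace ℝ (Fin p)) :
    act M (c • ∑ i, s i • v i) = c • ∑ i, s i • act M (v i) := by
  have h : ∀ w, act M w = Matrix.toEuclideanLin M w := fun w => rfl
  simp only [h, map_smul, map_sum]

theorem inner_act {M : Matrix (Fin p) (Fin p) ℝ} (hM : M.transpose = M)
    (u v : EuclideanSpace ℝ (Fin p)) : inner ℝ (act M u) v = inner ℝ u (act M v) := by
  simp only [EuclideanSpace.inner_eq_star_dotProduct, act, star_trivial]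
  rw [Matrix.dotProduct_mulVec, ← Matrix.mulVec_transpose, hM]

theorem inner_act_sum_vecMulVec (c : Fin n → ℝ) (Ψ : Fin n → EuclideanSpace ℝ (Fin p))
    (u : EuclideanSpace ℝ (Fin p)) :
    inner ℝ u (act (∑ i, c i • Matrix.vecMulVec (Ψ i).ofLp (Ψ i).ofLp) u)
      = ∑ i, c i * inner ℝ (Ψ i) u ^ 2 := by
  simp only [EuclideanSpace.inner_eq_star_dotProduct, act, star_trivial, Matrix.sum_mulVec,
    sum_dotProduct, Matrix.smul_mulVec, Matrix.vecMulVec_mulVec, smul_dotProduct]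
  refine Finset.sum_congr rfl fun i _ => ?_
  rw [dotProduct_comm u.ofLp]
  simp only [op_smul_eq_smul, smul_eq_mul]
  ring

theorem posSqrt_transpose (M : Matrix (Fin p) (Fin p) ℝ) : (posSqrt M).transpose = posSqrt M := by
  simpa [Matrix.IsHermitian] using (posSqrt_posSemidef M).isHermitian

theorem norm_sq_act_posSqrt {M : Matrix (Fin p) (Fin p) ℝ} (hM : M.PosSemidef)
    (u : EuclideanSpace ℝ (Fin p)) : ‖act (posSqrt M) u‖ ^ 2 = inner ℝ u (act M u) := by
  rw [← real_inner_self_eq_norm_sq, inner_act (posSqrt_transpose M), act_mul, posSqrt_mul_self hM]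

theorem isUnit_det_posSqrt {M : Matrix (Fin p) (Fin p) ℝ} (hM : M.PosDef) :
    IsUnit (posSqrt M).det := by
  have h := hM.det_pos
  rw [← posSqrt_mul_self hM.posSemidef, Matrix.det_mul] at h
  refine isUnit_iff_ne_zero.2 fun h0 => ?_
  rw [h0] at h
  simp at h

theorem V0sq_eq (Ψ : Fin n → EuclideanSpace ℝ (Fin p)) :
    V0sq Ψ = ∑ i, (1 / 4 : ℝ) • Matrix.vecMulVec (Ψ i).ofLp (Ψ i).ofLp := by
  rw [V0sq, Finset.smul_sum]

theorem norm_sq_act_V0 {Ψ : Fin n → EuclideanSpace ℝ (Fin p)} (h : (V0sq Ψ).PosDef)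
    (u : EuclideanSpace ℝ (Fin p)) : ‖act (V0 Ψ) u‖ ^ 2 = 1 / 4 * ∑ i, inner ℝ (Ψ i) u ^ 2 := by
  rw [V0, norm_sq_act_posSqrt h.posSemidef, V0sq_eq, inner_act_sum_vecMulVec, Finset.mul_sum]

theorem D0sq_posDef {Ψ : Fin n → EuclideanSpace ℝ (Fin p)} {dens : Fin n → ℝ → ℝ}
    (h : (V0sq Ψ).PosDef) (hpos : ∀ i, 0 < dens i 0) : (D0sq Ψ dens).PosDef := by
  refine Matrix.PosDef.of_dotProduct_mulVec_pos ?_ fun x hx => ?_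
  · simp [Matrix.IsHermitian, D0sq, Matrix.transpose_sum, Matrix.transpose_vecMulVec]
  · have hq : ∀ M : Matrix (Fin p) (Fin p) ℝ, star x ⬝ᵥ M.mulVec x
        = inner ℝ (WithLp.toLp 2 x) (act M (WithLp.toLp 2 x)) := fun M => by
      simp [EuclideanSpace.inner_eq_star_dotProduct, act, dotProduct_comm]
    have h1 := h.dotProduct_mulVec_pos hx
    rw [hq, V0sq_eq, inner_act_sum_vecMulVec] at h1
    rw [hq, D0sq, inner_act_sum_vecMulVec]
    obtain ⟨i, hi, h2⟩ := Finset.exists_lt_of_sum_lt (by simpa using h1 :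
      ∑ _i : Fin n, (0 : ℝ) < _)
    refine Finset.sum_pos' (fun i _ => mul_nonneg (hpos i).le (sq_nonneg _)) ⟨i, hi, ?_⟩
    exact mul_pos (hpos i) (by linarith)

/-- The leverage bound expressed by the effective sample size. -/
theorem inner_sq_le_effN {Ψ : Fin n → EuclideanSpace ℝ (Fin p)} (h : (V0sq Ψ).PosDef) (i : Fin n)
    (γ : EuclideanSpace ℝ (Fin p)) :
    |inner ℝ (Ψ i) γ| ≤ 2 * ‖act (V0 Ψ) γ‖ * √(1 / effN Ψ) := by
  set F : Fin n → EuclideanSpace ℝ (Fin p) → ℝ := fun i γ =>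
    inner ℝ (Ψ i) γ / (2 * ‖act (V0 Ψ) γ‖) with hF
  set S := ⨆ i, ⨆ γ, F i γ with hS
  -- One summand is at most the whole form 4‖V₀γ‖². The quotients are thus at most 1, so the real
  -- suprema are genuine.
  have habs : ∀ i γ, |inner ℝ (Ψ i) γ| ≤ 2 * ‖act (V0 Ψ) γ‖ := fun i γ => by
    refine abs_le_of_sq_le_sq ?_ (by positivity)
    rw [mul_pow, norm_sq_act_V0 h]
    have := Finset.single_le_sum (f := fun i => inner ℝ (Ψ i) γ ^ 2) (fun i _ => sq_nonneg _)
      (Finset.mem_univ i)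
    linarith
  have hF1 : ∀ i γ, F i γ ≤ 1 := fun i γ =>
    div_le_one_of_le₀ ((le_abs_self _).trans (habs i γ)) (by positivity)
  have hbdd : ∀ i, BddAbove (Set.range (F i)) := fun i => ⟨1, by rintro _ ⟨γ, rfl⟩; exact hF1 i γ⟩
  have hFS : ∀ i γ, F i γ ≤ S := fun i γ =>
    (le_ciSup (hbdd i) γ).trans (le_ciSup (f := fun i => ⨆ γ, F i γ) (Set.finite_range _).bddAbove i)
  have hS0 : 0 ≤ S := by
    have := hFS i 0
    simpa [hF] using this
  have hSN : √(1 / effN Ψ) = S := by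
    rw [effN, one_div, inv_inv, Real.sqrt_sq hS0]
  have hle : ∀ γ, inner ℝ (Ψ i) γ ≤ 2 * ‖act (V0 Ψ) γ‖ * S := fun γ => by
    rcases (norm_nonneg (act (V0 Ψ) γ)).eq_or_lt with h0 | h0
    · have := habs i γ
      rw [← h0] at this ⊢
      linarith [le_abs_self (inner ℝ (Ψ i) γ)]
    · have := hFS i γ
      rw [hF] at this
      simp only at this
      rw [div_le_iff₀ (by positivity)] at this
      linarith
  rw [hSN]
  refine abs_le.2 ⟨?_, hle γ⟩
  have h1 := hle (-γ)
  have h2 : ‖act (V0 Ψ) (-γ)‖ = ‖act (V0 Ψ) γ‖ := by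
    simp [act, Matrix.mulVec_neg]
  rw [h2, inner_neg_right] at h1
  linarith

end Matrices

/-! ### Change of coordinates by D₀. -/

/-- The features in the coordinates in which the information matrix is the identity. -/
def normFeature {n p : ℕ} (Ψ : Fin n → EuclideanSpace ℝ (Fin p)) (dens : Fin n → ℝ → ℝ)
    (i : Fin n) : EuclideanSpace ℝ (Fin p) :=
  act (D0 Ψ dens)⁻¹ (Ψ i)

section Coordinates

variable {n p : ℕ} {Ψ : Fin n → EuclideanSpace ℝ (Fin p)} {dens : Fin n → ℝ → ℝ}

theorem inner_normFeature (i : Fin n) (u : EuclideanSpace ℝ (Fin p)) :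
    inner ℝ (normFeature Ψ dens i) u = inner ℝ (Ψ i) (act (D0 Ψ dens)⁻¹ u) :=
  inner_act (by rw [Matrix.transpose_nonsing_inv, D0, posSqrt_transpose]) _ _

theorem act_D0_act_inv (h : (D0sq Ψ dens).PosDef) (u : EuclideanSpace ℝ (Fin p)) :
    act (D0 Ψ dens) (act (D0 Ψ dens)⁻¹ u) = u := by
  rw [act_mul, D0, Matrix.mul_nonsing_inv _ (isUnit_det_posSqrt h), act_one]

theorem act_inv_act_D0 (h : (D0sq Ψ dens).PosDef) (u : EuclideanSpace ℝ (Fin p)) :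
    act (D0 Ψ dens)⁻¹ (act (D0 Ψ dens) u) = u := by
  rw [act_mul, D0, Matrix.nonsing_inv_mul _ (isUnit_det_posSqrt h), act_one]

theorem sum_normFeature (h : (D0sq Ψ dens).PosDef) (u : EuclideanSpace ℝ (Fin p)) :
    ∑ i, dens i 0 * inner ℝ (normFeature Ψ dens i) u ^ 2 = ‖u‖ ^ 2 := by
  simp only [inner_normFeature]
  rw [← inner_act_sum_vecMulVec, ← D0sq, ← norm_sq_act_posSqrt h.posSemidef, ← D0,
    act_D0_act_inv h]

theorem sum_sq_normFeature_le {a : ℝ} (ha : 0 < a) (h : (D0sq Ψ dens).PosDef)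
    (hda : ∀ i, a ^ 2 / 4 ≤ dens i 0) (u : EuclideanSpace ℝ (Fin p)) :
    ∑ i, inner ℝ (normFeature Ψ dens i) u ^ 2 ≤ 4 * ‖u‖ ^ 2 / a ^ 2 := by
  rw [le_div_iff₀ (by positivity), ← sum_normFeature h u, Finset.sum_mul, Finset.mul_sum]
  refine Finset.sum_le_sum fun i _ => ?_
  nlinarith [hda i, sq_nonneg (inner ℝ (normFeature Ψ dens i) u)]

/-- The bound pᵢ(0) ≥ a²/4 means D₀² ≥ a²V₀², so V₀D₀⁻¹ has norm at most 1/a. The leverage bound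
does the rest. -/
theorem abs_inner_normFeature_le {a : ℝ} (ha : 0 < a) (hV : (V0sq Ψ).PosDef)
    (h : (D0sq Ψ dens).PosDef) (hda : ∀ i, a ^ 2 / 4 ≤ dens i 0) (i : Fin n)
    (u : EuclideanSpace ℝ (Fin p)) :
    |inner ℝ (normFeature Ψ dens i) u| ≤ 2 / a * √(1 / effN Ψ) * ‖u‖ := by
  have h1 : ‖act (V0 Ψ) (act (D0 Ψ dens)⁻¹ u)‖ ≤ ‖u‖ / a := by
    refine le_of_sq_le_sq ?_ (by positivity)
    rw [norm_sq_act_V0 hV]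
    have := sum_sq_normFeature_le ha h hda u
    simp only [inner_normFeature] at this
    rw [div_pow]
    calc 1 / 4 * ∑ i, inner ℝ (Ψ i) (act (D0 Ψ dens)⁻¹ u) ^ 2
        ≤ 1 / 4 * (4 * ‖u‖ ^ 2 / a ^ 2) := by gcongr
      _ = _ := by ring
  rw [inner_normFeature]
  calc |inner ℝ (Ψ i) (act (D0 Ψ dens)⁻¹ u)|
      ≤ 2 * ‖act (V0 Ψ) (act (D0 Ψ dens)⁻¹ u)‖ * √(1 / effN Ψ) := inner_sq_le_effN hV i _
    _ ≤ 2 * (‖u‖ / a) * √(1 / effN Ψ) := by gcongr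
    _ = _ := by ring

theorem normalized_logLik (y : Fin n → ℝ) (θs u : EuclideanSpace ℝ (Fin p)) :
    inner ℝ (scoreSum (normFeature Ψ dens) fun i => y i - inner ℝ (Ψ i) θs) u
        - remSum (normFeature Ψ dens) (fun i => y i - inner ℝ (Ψ i) θs) u
      = logLik Ψ y (θs + act (D0 Ψ dens)⁻¹ u) - logLik Ψ y θs := by
  rw [logLik_sub_eq, add_sub_cancel_left, inner_scoreSum, inner_scoreSum, remSum, remSum]
  simp only [inner_normFeature]

theorem score_eq_scoreSum (y : Fin n → ℝ) (θs : EuclideanSpace ℝ (Fin p))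
    (hy : ∀ i, y i - inner ℝ (Ψ i) θs ≠ 0) :
    score Ψ dens θs y = scoreSum (normFeature Ψ dens) fun i => y i - inner ℝ (Ψ i) θs := by
  rw [score, gradient_logLik Ψ y θs hy, scoreSum, act_smul_sum]
  rfl

end Coordinates

/-! ### Choice of the mesh ε and the final theorem. -/

/-- The relative radius of the nets at the effective sample size `t` per degree of freedom. -/
def netScale (a t : ℝ) : ℝ := (640000 / (a ^ 4 * t)) ^ (1 / 8 : ℝ)

theorem netScale_pos {a t : ℝ} (ha : 0 < a) (ht : 0 < t) : 0 < netScale a t :=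
  Real.rpow_pos_of_pos (by positivity) _

theorem netScale_pow {a t : ℝ} (ht : 0 < t) : netScale a t ^ 8 = 640000 / (a ^ 4 * t) := by
  rw [netScale, ← Real.rpow_natCast, ← Real.rpow_mul (by positivity)]
  norm_num

theorem tendsto_netScale {a : ℝ} (ha : 0 < a) : Tendsto (netScale a) atTop (𝓝 0) := by
  have h1 : Tendsto (fun t : ℝ => 640000 / (a ^ 4 * t)) atTop (𝓝 0) :=
    (tendsto_id.const_mul_atTop (by positivity : 0 < a ^ 4)).const_div_atTop _
  have h2 := h1.rpow_const (p := 1 / 8) (Or.inr (by norm_num))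
  rwa [Real.zero_rpow (by norm_num)] at h2

theorem netScale_le {a t ε₀ : ℝ} (ha : 0 < a) (ht : 0 < t) (hε₀ : 0 < ε₀)
    (h : 640000 / (a ^ 4 * ε₀ ^ 8) ≤ t) : netScale a t ≤ ε₀ := by
  refine le_of_pow_le_pow_left₀ (n := 8) (by norm_num) hε₀.le ?_
  rw [netScale_pow ht]
  rw [div_le_iff₀ (by positivity)] at h ⊢
  linarith

/-- This equation dictates the definition of `netScale`: the largest shift on the net ball,
800/(a²√t) with t = N/q, has to be ε⁴. -/
theorem radius_eq_netScale {a N q : ℝ} (ha : 0 < a) (hN : 0 < N) (hq : 0 < q) :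
    2 / a * √(1 / N) * (400 * √q / a) = netScale a (N / q) ^ 4 := by
  refine (pow_left_inj₀ (by positivity)
    (pow_nonneg (netScale_pos ha (by positivity)).le 4) two_ne_zero).1 ?_
  rw [← pow_mul, netScale_pow (by positivity), mul_pow, mul_pow, div_pow, div_pow, mul_pow,
    Real.sq_sqrt (by positivity), Real.sq_sqrt hq.le]
  field_simp
  norm_num

end

end LAD

theorem mainTheorem12 (C a : ℝ) (hC : 0 < C) (ha : 0 < a) :
    ∃ (C₂ K : ℝ) (κ : ℝ → ℝ), 0 < C₂ ∧ 0 < K ∧ Tendsto κ atTop (𝓝 0) ∧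
      ∀ (n p : ℕ) (Ψ : Fin n → EuclideanSpace ℝ (Fin p))
        (Ω : Type*) [MeasurableSpace Ω] (P : Measure Ω) [IsProbabilityMeasure P]
        (Y : Fin n → Ω → ℝ) (θs : EuclideanSpace ℝ (Fin p)) (dens : Fin n → ℝ → ℝ)
        (ρ δ x : ℝ),
        0 < p →
        (LAD.V0sq Ψ).PosDef →
        -- independent observations
        (∀ i, Measurable (Y i)) →
        iIndepFun Y P →
        -- `θs` maximizes `E L(θ)`, written through the differences `E {L(θ) - L(θs)}`, which
        -- are finite even if the observations have no mean
        (∀ θ, ∫ ω, (LAD.logLik Ψ (fun i => Y i ω) θ - LAD.logLik Ψ (fun i => Y i ω) θs) ∂P ≤ 0) →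
        -- `dens i` is a density of the residual `Y i - Ψᵢᵀ θs`
        (∀ i, Measurable (dens i)) →
        (∀ i u, 0 ≤ dens i u) →
        (∀ i, P.map (fun ω => Y i ω - inner ℝ (Ψ i) θs) =
          volume.withDensity (fun u => ENNReal.ofReal (dens i u))) →
        -- the conditions on the densities
        (∀ i u, dens i u ≤ C) →
        (∀ i, a ^ 2 / 4 ≤ dens i 0) →
        0 < ρ → 0 < δ → δ < 1 / 2 →
        (∀ i u, |u| ≤ ρ → |dens i u / dens i 0 - 1| ≤ δ) →
        -- the condition on the effective sample size
        0 < x →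
        C₂ * ρ⁻¹ ^ 2 * a ^ 2 * (x + p) ≤ LAD.effN Ψ →
        ∃ A : Set Ω, MeasurableSet A ∧ 1 - Real.exp (-x) ≤ P.real A ∧
          ∀ ω ∈ A, ∀ θt : EuclideanSpace ℝ (Fin p),
            IsMaxOn (LAD.logLik Ψ (fun i => Y i ω)) Set.univ θt →
            ‖LAD.act (LAD.D0 Ψ dens) (θt - θs) - LAD.score Ψ dens θs (fun i => Y i ω)‖ ^ 2
                ≤ (K * δ + κ (LAD.effN Ψ / (x + p))) * (x + p) ∧
            |2 * (LAD.logLik Ψ (fun i => Y i ω) θt - LAD.logLik Ψ (fun i => Y i ω) θs)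
                - ‖LAD.score Ψ dens θs (fun i => Y i ω)‖ ^ 2|
                ≤ (K * δ + κ (LAD.effN Ψ / (x + p))) * (x + p) := by
  obtain ⟨T, hT⟩ : ∃ T : ℝ, T = 8 * C * 160000 / a ^ 4 + 4 := ⟨_, rfl⟩
  obtain ⟨W, hW⟩ : ∃ W : ℝ, W = 17 * (160000 / a ^ 2) + 17 * T := ⟨_, rfl⟩
  have hT0 : 0 < T := by rw [hT]; positivity
  have hW0 : 0 < W := by rw [hW]; positivity
  obtain ⟨ε₀, hε₀, hε₀16, hε₀W⟩ : ∃ ε₀ : ℝ, 0 < ε₀ ∧ ε₀ ≤ 1 / 16 ∧ ε₀ ≤ 1 / a ^ 2 / W :=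
    ⟨min (1 / 16) (1 / a ^ 2 / W), lt_min (by norm_num) (by positivity), min_le_left _ _,
      min_le_right _ _⟩
  -- The first summand of C₂ ensures ε⁴ ≤ ρ, the second ε ≤ ε₀. K and κ are four times the
  -- coefficients of δ and of 1 in the normalized error.
  refine ⟨640000 / a ^ 6 + 16 * 640000 / (a ^ 10 * ε₀ ^ 8), 20000 / a ^ 2,
    fun t => 4 * W * LAD.netScale a t, by positivity, by positivity, ?_, ?_⟩
  · simpa using (LAD.tendsto_netScale ha).const_mul (4 * W)
  intro n p Ψ Ω _ P _ Y θs dens ρ δ x hp hV hY hind hmax hd hd0 hlaw hdC hda hρ hδ0 hδ2 hδ hx hN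
  obtain ⟨q, hq⟩ : ∃ q : ℝ, q = x + p := ⟨_, rfl⟩
  rw [← hq] at hN ⊢
  have hq0 : 0 < q := by rw [hq]; positivity
  have hN0 : 0 < LAD.effN Ψ := lt_of_lt_of_le (by positivity) hN
  have hpos : ∀ i, 0 < dens i 0 := fun i => lt_of_lt_of_le (by positivity) (hda i)
  have hD := LAD.D0sq_posDef hV hpos
  have he : ∀ i, Measurable fun ω => Y i ω - inner ℝ (Ψ i) θs := fun i => (hY i).sub_const _
  -- For n = 0 the supremum is 0 by convention, so `effN` would be 0.
  have hn : Nonempty (Fin n) := by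
    by_contra hcon
    rw [not_nonempty_iff] at hcon
    simp [LAD.effN] at hN0
  obtain ⟨i₀⟩ := hn
  -- Total mass 1 limits ρ. This turns the condition on Nρ²/q into absolute lower bounds on N/q.
  have hρa : ρ * a ^ 2 ≤ 4 := by
    have := LAD.isProbabilityMeasure_of_law (he i₀) (hlaw i₀)
    exact LAD.rho_mul_le_four hδ2 ha (hda i₀) (hδ i₀)
  have hρinv : a ^ 4 / 16 ≤ ρ⁻¹ ^ 2 := by
    have h1 : a ^ 2 / 4 ≤ ρ⁻¹ := by
      rw [← one_div, div_le_div_iff₀ (by norm_num) hρ]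
      linarith
    calc a ^ 4 / 16 = (a ^ 2 / 4) ^ 2 := by ring
      _ ≤ _ := by gcongr
  obtain ⟨t, ht⟩ : ∃ t : ℝ, t = LAD.effN Ψ / q := ⟨_, rfl⟩
  have ht0 : 0 < t := by rw [ht]; positivity
  have htC : 640000 / a ^ 6 * ρ⁻¹ ^ 2 * a ^ 2
      + 16 * 640000 / (a ^ 10 * ε₀ ^ 8) * ρ⁻¹ ^ 2 * a ^ 2 ≤ t := by
    rw [ht, le_div_iff₀ hq0]
    linarith
  have ht1 : 640000 / a ^ 6 * ρ⁻¹ ^ 2 * a ^ 2 ≤ t := le_trans (by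
    have : 0 ≤ 16 * 640000 / (a ^ 10 * ε₀ ^ 8) * ρ⁻¹ ^ 2 * a ^ 2 := by positivity
    linarith) htC
  have ht2 : 640000 / (a ^ 4 * ε₀ ^ 8) ≤ t := by
    refine le_trans ?_ htC
    calc 640000 / (a ^ 4 * ε₀ ^ 8)
        = 16 * 640000 / (a ^ 10 * ε₀ ^ 8) * (a ^ 4 / 16) * a ^ 2 := by
          field_simp
      _ ≤ 16 * 640000 / (a ^ 10 * ε₀ ^ 8) * ρ⁻¹ ^ 2 * a ^ 2 := by gcongr
      _ ≤ _ := le_add_of_nonneg_left (by positivity)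
  have ht3 : 1 ≤ t := by
    refine le_trans ?_ ht1
    calc (1 : ℝ) ≤ 640000 / a ^ 6 * (a ^ 4 / 16) * a ^ 2 := by
          field_simp
          norm_num
      _ ≤ _ := by gcongr
  obtain ⟨ε, hε⟩ : ∃ ε : ℝ, ε = LAD.netScale a t := ⟨_, rfl⟩
  have hε0 : 0 < ε := hε ▸ LAD.netScale_pos ha ht0
  have hεle : ε ≤ ε₀ := hε ▸ LAD.netScale_le ha ht0 hε₀ ht2
  have hbR : 2 / a * √(1 / LAD.effN Ψ) * (400 * √q / a) = ε ^ 4 := by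
    rw [LAD.radius_eq_netScale ha hN0 hq0, hε, ht]
  have hερ : ε ^ 4 ≤ ρ := by
    refine le_of_sq_le_sq ?_ hρ.le
    rw [← pow_mul, hε, LAD.netScale_pow ht0, div_le_iff₀ (by positivity)]
    calc (640000 : ℝ) = ρ ^ 2 * (a ^ 4 * (640000 / a ^ 6 * ρ⁻¹ ^ 2 * a ^ 2)) := by
          field_simp
      _ ≤ _ := by gcongr
  have hbq : 2 / a * √(1 / LAD.effN Ψ) * (a * √q) ≤ 2 := by
    have h1 : √(1 / LAD.effN Ψ) * √q ≤ 1 := by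
      rw [← Real.sqrt_mul (by positivity), Real.sqrt_le_one, one_div, inv_mul_le_one₀ hN0]
      rw [ht, le_div_iff₀ hq0] at ht3
      linarith
    calc 2 / a * √(1 / LAD.effN Ψ) * (a * √q) = 2 * (√(1 / LAD.effN Ψ) * √q) := by
          field_simp
      _ ≤ 2 := by linarith
  obtain ⟨A, hA, hPA, hAω⟩ := LAD.normalized_expansion (α := LAD.normFeature Ψ dens)
    (e := fun i ω => Y i ω - inner ℝ (Ψ i) θs) he
    (hind.comp (fun i y => y - inner ℝ (Ψ i) θs) fun i => measurable_id.sub_const _)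
    hlaw hd hd0 hC hdC hpos hδ0.le hδ2 hδ ha hx hp hq (LAD.sum_normFeature hD)
    (LAD.sum_sq_normFeature_le ha hD hda) (by positivity)
    (LAD.abs_inner_normFeature_le ha hV hD hda) hbq
    (LAD.mean_score_eq_zero he hlaw hC hdC fun u => by
      simp only [LAD.normalized_logLik]
      exact hmax _)
    hbR (hbR.trans_le hερ) hT hW hε0 (hεle.trans hε₀16)
    ((le_div_iff₀ hW0).1 (hεle.trans hε₀W))
  refine ⟨A, hA, hPA, fun ω hω θt hθt => ?_⟩
  obtain ⟨hne, hv⟩ := hAω ω hω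
  have hθ : θs + LAD.act (LAD.D0 Ψ dens)⁻¹ (LAD.act (LAD.D0 Ψ dens) (θt - θs)) = θt := by
    rw [LAD.act_inv_act_D0 hD, add_sub_cancel]
  obtain ⟨h1, h2⟩ := hv (LAD.act (LAD.D0 Ψ dens) (θt - θs)) fun u => by
    rw [LAD.normalized_logLik (fun i => Y i ω), LAD.normalized_logLik (fun i => Y i ω), hθ]
    exact sub_le_sub_right (hθt (Set.mem_univ _)) _
  rw [LAD.normalized_logLik (fun i => Y i ω), hθ] at h2
  rw [LAD.score_eq_scoreSum (fun i => Y i ω) θs hne]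
  have hK : 4 * ((5000 * δ / a ^ 2 + ε * W) * q)
      = (20000 / a ^ 2 * δ + 4 * W * LAD.netScale a (LAD.effN Ψ / q)) * q := by
    rw [hε, ht]
    ring
  refine ⟨h1.trans_eq hK, h2.trans (le_trans ?_ hK.le)⟩
  have : 0 ≤ (5000 * δ / a ^ 2 + ε * W) * q := by positivity
  linarith
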